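/- Let $\delta\in\mathbb{C}$. Let $\mathcal{T}_\delta$ be the strict $\mathbb{C}$-linear monoidal category (with unit object $\mathbf 1$) generated by one object $\mathsf{go}$ and morphisms $$m\colon \mathsf{go}^{\otimes 2}\to\mathsf{go},\qquad s\colon \mathsf{go}^{\otimes 2}\to\mathsf{go}^{\otimes 2},\qquad u\colon\mathbf 1\to\mathsf{go}^{\otimes 2},\qquad c\colon\mathsf{go}^{\otimes 2}\to\mathbf 1 ,$$ subject to the following relations, in which $1=1_{\mathsf{go}}$, juxtaposition $gf$ means $g\circ f$, and $y:=(1\otimes m)(u\otimes 1)\colon\mathsf{go}\to\mathsf{go}^{\otimes 2}$: $$(c\otimes 1)(1\otimes u)=1=(1\otimes c)(u\otimes 1),\quad y=(m\otimes 1)(1\otimes u),\quad (1\otimes c)(s\otimes 1)=(c\otimes 1)(1\otimes s),$$ $$s s=1\otimes 1,\quad (s\otimes 1)(1\otimes s)(s\otimes 1)=(1\otimes s)(s\otimes 1)(1\otimes s),$$ $$(1\otimes m)(s\otimes 1)(1\otimes s)=s(m\otimes 1),\quad (1\otimes s)(s\otimes 1)(1\otimes y)=(y\otimes 1)s,$$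 $$cs=c,\quad ms=-m,\quad my=1,\quad cu=\delta\, 1_{\mathbf 1}.$$ A tensor ideal $\mathcal I$ of $\mathcal T_\delta$ is a family of linear subspaces $\mathcal I(X,Y)\subseteq\mathcal T_\delta(X,Y)$ closed under composition on either side with arbitrary morphisms and under tensoring on either side with identity morphisms; $\mathcal T_\delta/\mathcal I$ is the category with the same objects and with $(\mathcal T_\delta/\mathcal I)(X,Y)=\mathcal T_\delta(X,Y)/\mathcal I(X,Y)$. Put $$I:=ym,\qquad H:=(m\otimes 1)(1\otimes y),\qquad D:=(m\otimes 1)(1\otimes s)(y\otimes 1)$$ in $\mathcal T_\delta(\mathsf{go}^{\otimes2},\mathsf{go}^{\otimes2})$. Assume $\delta\notin\{-2,0,3,\tfrac{15+3\sqrt5}{4},\tfrac{15-3\sqrt5}{4}\}$, and let $\mathcal I$ be a tensor ideal of $\mathcal T_\delta$ such that $$\dim(\mathcal T_\delta/\mathcal I)(\mathsf{go}^{\otimes 2},\mathsf{go}^{\otimes 2})=5,\qquad \dim(\mathcal T_\delta/\mathcal I)(\mathsf{go}^{\otimes 2},\mathsf{go}^{\otimes 3})=16,$$ and such that the Jacobi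 relation $D=I-H$ holds in $\mathcal T_\delta/\mathcal I$. Then, in $(\mathcal T_\delta/\mathcal I)(\mathsf{go}^{\otimes2},\mathsf{go}^{\otimes3})$, the pentagon $$P:=(1\otimes m\otimes 1)(y\otimes y)H$$ satisfies $$P=\tfrac1{12}\,(t_1+t_2+t_3+t_4)+\tfrac{5}{12(\delta+2)}\,(a_1+a_2+\dots+a_{10}),$$ where $$t_1=(1\otimes m\otimes 1)(y\otimes y),\quad t_2=(y\otimes 1)ym,\quad t_3=(1\otimes y)ym,\quad t_4=t_1s,$$ $$a_1=(1\otimes y)uc,\quad a_2=1\otimes y,\quad a_3=y\otimes 1,\quad a_4=(u\otimes 1)m,\quad a_5=(1\otimes u)m,$$ $$a_6=(s\otimes 1)(1\otimes u)m,\quad a_7=(1\otimes s)(y\otimes 1),\quad a_8=(s\otimes 1)(1\otimes y),\quad a_9=(y\otimes 1)s,\quad a_{10}=(1\otimes y)s.$$ -/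

import Mathlib

open CategoryTheory MonoidalCategory

/-!
# The universal trivalent category and its quotients

The strict `ℂ`-linear monoidal category `𝒯_δ` is given by generators and relations.  It has one
generating object `go`; since the monoidal structure is strict, the objects are exactly the powers
`go^{⊗ n}`, and we use the natural number `n` for this power.
-/

/-- Formal `ℂ`-linear expressions for morphisms `go^{⊗ m} → go^{⊗ n}`, built from the four
generators by identities, composition, tensor product and linear combinations.
`comp f g` is `g ∘ f`: first `f` (drawn below), then `g` (drawn above). -/
inductive Diag : ℕ → ℕ → Type
  | merge : Diag 2 1
  | cross : Diag 2 2
  | cup : Diag 0 2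
  | cap : Diag 2 0
  | id (n : ℕ) : Diag n n
  | comp {m n p : ℕ} (f : Diag m n) (g : Diag n p) : Diag m p
  | tensor {m n m' n' : ℕ} (f : Diag m n) (g : Diag m' n') : Diag (m + m') (n + n')
  | zero (m n : ℕ) : Diag m n
  | add {m n : ℕ} (f g : Diag m n) : Diag m n
  | smul {m n : ℕ} (c : ℂ) (f : Diag m n) : Diag m n

namespace Diag

/-- Transport of an expression along equalities of source and target. -/
def cast {m n m' n' : ℕ} (hm : m = m') (hn : n = n') (f : Diag m n) : Diag m' n' :=
  hm ▸ hn ▸ f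

/-- The morphism `go → go ⊗ go`, obtained from `merge` by bending its left leg up. -/
def split : Diag 1 2 :=
  comp (tensor cup (id 1) : Diag 1 3) (tensor (id 1) merge : Diag 3 2)

/-- The congruence on formal expressions whose classes are the morphisms of `𝒯_δ`: it is generated
by the axioms of a strict `ℂ`-linear monoidal category together with the defining relations. -/
inductive Rel (δ : ℂ) : ∀ {m n : ℕ}, Diag m n → Diag m n → Prop
  -- equivalence relation and congruence
  | refl {m n : ℕ} (f : Diag m n) : Rel δ f f
  | symm {m n : ℕ} {f g : Diag m n} : Rel δ f g → Rel δ g f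
  | trans {m n : ℕ} {f g h : Diag m n} : Rel δ f g → Rel δ g h → Rel δ f h
  | comp_congr {m n p : ℕ} {f f' : Diag m n} {g g' : Diag n p} :
      Rel δ f f' → Rel δ g g' → Rel δ (comp f g) (comp f' g')
  | tensor_congr {m n m' n' : ℕ} {f f' : Diag m n} {g g' : Diag m' n'} :
      Rel δ f f' → Rel δ g g' → Rel δ (tensor f g) (tensor f' g')
  | add_congr {m n : ℕ} {f f' g g' : Diag m n} :
      Rel δ f f' → Rel δ g g' → Rel δ (add f g) (add f' g')
  | smul_congr {m n : ℕ} (c : ℂ) {f f' : Diag m n} :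
      Rel δ f f' → Rel δ (smul c f) (smul c f')
  -- the morphisms with fixed source and target form a vector space
  | add_comm {m n : ℕ} (f g : Diag m n) : Rel δ (add f g) (add g f)
  | add_assoc {m n : ℕ} (f g h : Diag m n) : Rel δ (add (add f g) h) (add f (add g h))
  | zero_add {m n : ℕ} (f : Diag m n) : Rel δ (add (zero m n) f) f
  | neg_add {m n : ℕ} (f : Diag m n) : Rel δ (add (smul (-1) f) f) (zero m n)
  | one_smul {m n : ℕ} (f : Diag m n) : Rel δ (smul 1 f) f
  | mul_smul {m n : ℕ} (c d : ℂ) (f : Diag m n) : Rel δ (smul (c * d) f) (smul c (smul d f))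
  | smul_add {m n : ℕ} (c : ℂ) (f g : Diag m n) :
      Rel δ (smul c (add f g)) (add (smul c f) (smul c g))
  | add_smul {m n : ℕ} (c d : ℂ) (f : Diag m n) :
      Rel δ (smul (c + d) f) (add (smul c f) (smul d f))
  -- composition and tensor product are bilinear
  | add_comp {m n p : ℕ} (f f' : Diag m n) (g : Diag n p) :
      Rel δ (comp (add f f') g) (add (comp f g) (comp f' g))
  | comp_add {m n p : ℕ} (f : Diag m n) (g g' : Diag n p) :
      Rel δ (comp f (add g g')) (add (comp f g) (comp f g'))
  | smul_comp {m n p : ℕ} (c : ℂ) (f : Diag m n) (g : Diag n p) :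
      Rel δ (comp (smul c f) g) (smul c (comp f g))
  | comp_smul {m n p : ℕ} (c : ℂ) (f : Diag m n) (g : Diag n p) :
      Rel δ (comp f (smul c g)) (smul c (comp f g))
  | add_tensor {m n m' n' : ℕ} (f f' : Diag m n) (g : Diag m' n') :
      Rel δ (tensor (add f f') g) (add (tensor f g) (tensor f' g))
  | tensor_add {m n m' n' : ℕ} (f : Diag m n) (g g' : Diag m' n') :
      Rel δ (tensor f (add g g')) (add (tensor f g) (tensor f g'))
  | smul_tensor {m n m' n' : ℕ} (c : ℂ) (f : Diag m n) (g : Diag m' n') :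
      Rel δ (tensor (smul c f) g) (smul c (tensor f g))
  | tensor_smul {m n m' n' : ℕ} (c : ℂ) (f : Diag m n) (g : Diag m' n') :
      Rel δ (tensor f (smul c g)) (smul c (tensor f g))
  -- category axioms
  | id_comp {m n : ℕ} (f : Diag m n) : Rel δ (comp (id m) f) f
  | comp_id {m n : ℕ} (f : Diag m n) : Rel δ (comp f (id n)) f
  | comp_assoc {m n p q : ℕ} (f : Diag m n) (g : Diag n p) (h : Diag p q) :
      Rel δ (comp (comp f g) h) (comp f (comp g h))
  -- strict monoidal category axioms
  | tensor_id (m n : ℕ) : Rel δ (tensor (id m) (id n)) (id (m + n))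
  | interchange {m n p m' n' p' : ℕ} (f : Diag m n) (g : Diag n p) (f' : Diag m' n')
      (g' : Diag n' p') :
      Rel δ (tensor (comp f g) (comp f' g')) (comp (tensor f f') (tensor g g'))
  | tensor_assoc {m n m' n' m'' n'' : ℕ} (f : Diag m n) (g : Diag m' n') (h : Diag m'' n'') :
      Rel δ (cast (Nat.add_assoc m m' m'') (Nat.add_assoc n n' n'') (tensor (tensor f g) h))
        (tensor f (tensor g h))
  | unit_tensor {m n : ℕ} (f : Diag m n) :
      Rel δ (cast (Nat.zero_add m) (Nat.zero_add n) (tensor (id 0) f)) f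
  | tensor_unit {m n : ℕ} (f : Diag m n) :
      Rel δ (cast (Nat.add_zero m) (Nat.add_zero n) (tensor f (id 0))) f
  -- cup and cap straighten
  | zigzag_left :
      Rel δ (comp (tensor (id 1) cup : Diag 1 3) (tensor cap (id 1) : Diag 3 1)) (id 1)
  | zigzag_right :
      Rel δ (comp (tensor cup (id 1) : Diag 1 3) (tensor (id 1) cap : Diag 3 1)) (id 1)
  -- bending up the left leg or the right leg of `merge` gives the same morphism
  | split_eq :
      Rel δ split (comp (tensor (id 1) cup : Diag 1 3) (tensor merge (id 1) : Diag 3 2))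
  -- a strand can be pulled across a cap
  | cross_cap :
      Rel δ (comp (tensor cross (id 1) : Diag 3 3) (tensor (id 1) cap : Diag 3 1))
        (comp (tensor (id 1) cross : Diag 3 3) (tensor cap (id 1) : Diag 3 1))
  -- the crossing is a symmetric braiding, natural in `merge` and `split`
  | cross_cross : Rel δ (comp cross cross) (id 2)
  | braid :
      Rel δ
        (comp (tensor cross (id 1) : Diag 3 3)
          (comp (tensor (id 1) cross : Diag 3 3) (tensor cross (id 1) : Diag 3 3)))
        (comp (tensor (id 1) cross : Diag 3 3)
          (comp (tensor cross (id 1) : Diag 3 3) (tensor (id 1) cross : Diag 3 3)))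
  | cross_merge :
      Rel δ
        (comp (tensor (id 1) cross : Diag 3 3)
          (comp (tensor cross (id 1) : Diag 3 3) (tensor (id 1) merge : Diag 3 2)))
        (comp (tensor merge (id 1) : Diag 3 2) cross)
  | split_cross :
      Rel δ
        (comp (tensor (id 1) split : Diag 2 3)
          (comp (tensor cross (id 1) : Diag 3 3) (tensor (id 1) cross : Diag 3 3)))
        (comp cross (tensor split (id 1) : Diag 2 3))
  -- symmetry of the form, skew-symmetry of the product, bigon, circle
  | cap_symm : Rel δ (comp cross cap) cap
  | merge_skew : Rel δ (comp cross merge) (smul (-1) merge)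
  | bigon : Rel δ (comp split merge) (id 1)
  | circle : Rel δ (comp cup cap) (smul δ (id 0))

/-- `Rel δ` as a setoid. -/
def setoid (δ : ℂ) (m n : ℕ) : Setoid (Diag m n) where
  r := Rel δ
  iseqv := ⟨Rel.refl, Rel.symm, Rel.trans⟩

end Diag

/-- The objects of `𝒯_δ`: `⟨n⟩` is the tensor power `go^{⊗ n}` of the generating object. -/
structure Tcat (δ : ℂ) where
  /-- The exponent `n` of `go^{⊗ n}`. -/
  exponent : ℕ

/-- The morphisms `go^{⊗ m} → go^{⊗ n}` of `𝒯_δ`. -/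
def THom (δ : ℂ) (m n : ℕ) : Type := Quotient (Diag.setoid δ m n)

namespace THom

variable {δ : ℂ}

/-- The morphism represented by a formal expression. -/
def mk {m n : ℕ} (f : Diag m n) : THom δ m n := Quotient.mk (Diag.setoid δ m n) f

theorem sound {m n : ℕ} {f g : Diag m n} (h : Diag.Rel δ f g) : (mk f : THom δ m n) = mk g :=
  Quotient.sound h

theorem ind {m n : ℕ} {P : THom δ m n → Prop} (h : ∀ f, P (mk f)) (x : THom δ m n) : P x :=
  Quotient.ind h x

/-- The identity morphism of `go^{⊗ n}`. -/
def id (n : ℕ) : THom δ n n := mk (Diag.id n)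

/-- Composition: first `f`, then `g`. -/
def comp {m n p : ℕ} (f : THom δ m n) (g : THom δ n p) : THom δ m p :=
  Quotient.map₂ Diag.comp (fun _ _ h _ _ h' => Diag.Rel.comp_congr h h') f g

/-- Tensor product: `f` to the left of `g`. -/
def tensor {m n m' n' : ℕ} (f : THom δ m n) (g : THom δ m' n') : THom δ (m + m') (n + n') :=
  Quotient.map₂ Diag.tensor (fun _ _ h _ _ h' => Diag.Rel.tensor_congr h h') f g

instance (m n : ℕ) : Zero (THom δ m n) := ⟨mk (Diag.zero m n)⟩

instance (m n : ℕ) : Add (THom δ m n) :=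
  ⟨Quotient.map₂ Diag.add (fun _ _ h _ _ h' => Diag.Rel.add_congr h h')⟩

instance (m n : ℕ) : SMul ℂ (THom δ m n) :=
  ⟨fun c => Quotient.map (Diag.smul c) (fun _ _ h => Diag.Rel.smul_congr c h)⟩

instance (m n : ℕ) : Neg (THom δ m n) := ⟨fun f => (-1 : ℂ) • f⟩

instance (m n : ℕ) : AddCommGroup (THom δ m n) :=
  have zero_add' : ∀ f : THom δ m n, 0 + f = f := ind fun f => sound (.zero_add f)
  have add_comm' : ∀ f g : THom δ m n, f + g = g + f :=
    ind fun f => ind fun g => sound (.add_comm f g)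
  { add_assoc := ind fun f => ind fun g => ind fun h => sound (.add_assoc f g h)
    zero_add := zero_add'
    add_zero := fun f => (add_comm' f 0).trans (zero_add' f)
    add_comm := add_comm'
    neg_add_cancel := ind fun f => sound (.neg_add f)
    nsmul := nsmulRec
    zsmul := zsmulRec }

instance (m n : ℕ) : Module ℂ (THom δ m n) :=
  Module.ofMinimalAxioms
    (fun c => ind fun f => ind fun g => sound (.smul_add c f g))
    (fun c d => ind fun f => sound (.add_smul c d f))
    (fun c d => ind fun f => sound (.mul_smul c d f))
    (ind fun f => sound (.one_smul f))

end THom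

/-! ### `𝒯_δ` as a `ℂ`-linear monoidal category -/

namespace Tcat

variable {δ : ℂ}

/-- The object `go^{⊗ n}`. -/
abbrev goPow (δ : ℂ) (n : ℕ) : Tcat δ := ⟨n⟩

instance : Category (Tcat δ) where
  Hom X Y := THom δ X.exponent Y.exponent
  id X := THom.id X.exponent
  comp f g := THom.comp f g
  id_comp := THom.ind fun f => THom.sound (.id_comp f)
  comp_id := THom.ind fun f => THom.sound (.comp_id f)
  assoc := THom.ind fun f => THom.ind fun g => THom.ind fun h => THom.sound (.comp_assoc f g h)

instance : Preadditive (Tcat δ) where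
  homGroup X Y := inferInstanceAs (AddCommGroup (THom δ X.exponent Y.exponent))
  add_comp _ _ _ := THom.ind fun f => THom.ind fun f' => THom.ind fun g =>
    THom.sound (.add_comp f f' g)
  comp_add _ _ _ := THom.ind fun f => THom.ind fun g => THom.ind fun g' =>
    THom.sound (.comp_add f g g')

instance : Linear ℂ (Tcat δ) where
  homModule X Y := inferInstanceAs (Module ℂ (THom δ X.exponent Y.exponent))
  smul_comp _ _ _ c := THom.ind fun f => THom.ind fun g => THom.sound (.smul_comp c f g)
  comp_smul _ _ _ := THom.ind fun f c => THom.ind fun g => THom.sound (.comp_smul c f g)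

/-- The tensor product of objects is strictly associative and unital. -/
theorem obj_assoc (X Y Z : Tcat δ) :
    (⟨X.exponent + Y.exponent + Z.exponent⟩ : Tcat δ) = ⟨X.exponent + (Y.exponent + Z.exponent)⟩ :=
  congrArg Tcat.mk (Nat.add_assoc X.exponent Y.exponent Z.exponent)

theorem obj_zero_add (X : Tcat δ) : (⟨0 + X.exponent⟩ : Tcat δ) = X :=
  congrArg Tcat.mk (Nat.zero_add X.exponent)

theorem obj_add_zero (X : Tcat δ) : (⟨X.exponent + 0⟩ : Tcat δ) = X :=
  congrArg Tcat.mk (Nat.add_zero X.exponent)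

instance : MonoidalCategoryStruct (Tcat δ) where
  tensorObj X Y := ⟨X.exponent + Y.exponent⟩
  whiskerLeft X _ _ f := THom.tensor (THom.id X.exponent) f
  whiskerRight f Y := THom.tensor f (THom.id Y.exponent)
  tensorHom f g := THom.tensor f g
  tensorUnit := ⟨0⟩
  associator X Y Z := eqToIso (obj_assoc X Y Z)
  leftUnitor X := eqToIso (obj_zero_add X)
  rightUnitor X := eqToIso (obj_add_zero X)

theorem associator_hom (X Y Z : Tcat δ) :
    (α_ X Y Z).hom = eqToHom (show (X ⊗ Y) ⊗ Z = X ⊗ Y ⊗ Z from obj_assoc X Y Z) := rfl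

theorem leftUnitor_hom (X : Tcat δ) :
    (λ_ X).hom = eqToHom (show 𝟙_ (Tcat δ) ⊗ X = X from obj_zero_add X) := rfl

theorem rightUnitor_hom (X : Tcat δ) :
    (ρ_ X).hom = eqToHom (show X ⊗ 𝟙_ (Tcat δ) = X from obj_add_zero X) := rfl

theorem natural_of_cast {m n m' n' : ℕ} {hm : m = m'} {hn : n = n'} {f : Diag m n}
    {f' : Diag m' n'} (h : (THom.mk (Diag.cast hm hn f) : THom δ m' n') = THom.mk f') :
    (THom.mk f : goPow δ m ⟶ goPow δ n) ≫ eqToHom (congrArg Tcat.mk hn) =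
      eqToHom (congrArg Tcat.mk hm) ≫ (THom.mk f' : goPow δ m' ⟶ goPow δ n') := by
  subst hm hn
  rw [eqToHom_refl, eqToHom_refl]
  exact (Category.comp_id (X := goPow δ m) (Y := goPow δ n) _).trans
    (Eq.trans h (Category.id_comp (X := goPow δ m) (Y := goPow δ n) _).symm)

theorem eqToHom_whisker {X Y : Tcat δ} (h : X = Y) (Z : Tcat δ) :
    eqToHom h ▷ Z = eqToHom (congrArg (fun X' : Tcat δ => X' ⊗ Z) h) := by
  subst h
  exact THom.sound (.tensor_id X.exponent Z.exponent)

theorem whisker_eqToHom {X Y : Tcat δ} (Z : Tcat δ) (h : X = Y) :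
    Z ◁ eqToHom h = eqToHom (congrArg (fun X' : Tcat δ => Z ⊗ X') h) := by
  subst h
  exact THom.sound (.tensor_id Z.exponent X.exponent)

instance : MonoidalCategory (Tcat δ) where
  tensorHom_def := THom.ind fun f => THom.ind fun g =>
    (THom.sound ((Diag.Rel.tensor_congr (.symm (.comp_id f)) (.symm (.id_comp g))).trans
      (.interchange f (.id _) (.id _) g)))
  id_tensorHom_id X Y := THom.sound (.tensor_id X.exponent Y.exponent)
  tensorHom_comp_tensorHom := THom.ind fun f => THom.ind fun f' => THom.ind fun g =>
    THom.ind fun g' => THom.sound (.symm (.interchange f g f' g'))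
  whiskerLeft_id X Y := THom.sound (.tensor_id X.exponent Y.exponent)
  id_whiskerRight X Y := THom.sound (.tensor_id X.exponent Y.exponent)
  associator_naturality := THom.ind fun f => THom.ind fun g => THom.ind fun h =>
    natural_of_cast (THom.sound (.tensor_assoc f g h))
  leftUnitor_naturality := THom.ind fun f => natural_of_cast (THom.sound (.unit_tensor f))
  rightUnitor_naturality := THom.ind fun f => natural_of_cast (THom.sound (.tensor_unit f))
  pentagon W X Y Z := by
    simp only [associator_hom, eqToHom_whisker, whisker_eqToHom, eqToHom_trans]
  triangle X Y := by
    simp only [associator_hom, leftUnitor_hom, rightUnitor_hom, eqToHom_whisker, whisker_eqToHom, eqToHom_trans]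

instance : MonoidalPreadditive (Tcat δ) where
  whiskerLeft_zero {X Y Z} := by
    have h : X ◁ ((0 : Y ⟶ Z) + 0) = X ◁ (0 : Y ⟶ Z) + X ◁ (0 : Y ⟶ Z) :=
      THom.sound (.tensor_add (.id _) (.zero _ _) (.zero _ _))
    rwa [add_zero, left_eq_add] at h
  zero_whiskerRight {X Y Z} := by
    have h : ((0 : Y ⟶ Z) + 0) ▷ X = (0 : Y ⟶ Z) ▷ X + (0 : Y ⟶ Z) ▷ X :=
      THom.sound (.add_tensor (.zero _ _) (.zero _ _) (.id _))
    rwa [add_zero, left_eq_add] at h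
  whiskerLeft_add := THom.ind fun g => THom.ind fun g' =>
    THom.sound (.tensor_add (.id _) g g')
  add_whiskerRight := THom.ind fun f => THom.ind fun f' =>
    THom.sound (.add_tensor f f' (.id _))

instance : MonoidalLinear ℂ (Tcat δ) where
  whiskerLeft_smul _ _ _ c := THom.ind fun f => THom.sound (.tensor_smul c (.id _) f)
  smul_whiskerRight c _ _ := THom.ind fun f _ => THom.sound (.smul_tensor c f (.id _))

end Tcat

/-! ### Tensor ideals and quotients -/

/-- A tensor ideal of a `k`-linear monoidal category: a family of subspaces of the hom-spaces that
is closed under composition with, and under tensoring by identities of, arbitrary morphisms and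
objects on both sides. -/
structure TensorIdeal (k : Type*) (C : Type*) [Field k] [Category C] [Preadditive C] [Linear k C]
    [MonoidalCategory C] where
  /-- The subspace of the morphisms from `X` to `Y` that belong to the ideal. -/
  hom (X Y : C) : Submodule k (X ⟶ Y)
  mem_comp {X Y Z : C} (f : X ⟶ Y) (hf : f ∈ hom X Y) (g : Y ⟶ Z) : f ≫ g ∈ hom X Z
  comp_mem {X Y Z : C} (g : Z ⟶ X) (f : X ⟶ Y) (hf : f ∈ hom X Y) : g ≫ f ∈ hom Z Y
  whiskerLeft_mem {X Y : C} (Z : C) (f : X ⟶ Y) (hf : f ∈ hom X Y) : Z ◁ f ∈ hom (Z ⊗ X) (Z ⊗ Y)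
  whiskerRight_mem {X Y : C} (f : X ⟶ Y) (hf : f ∈ hom X Y) (Z : C) : f ▷ Z ∈ hom (X ⊗ Z) (Y ⊗ Z)

namespace TensorIdeal

variable {k : Type*} {C : Type*} [Field k] [Category C] [Preadditive C] [Linear k C]
  [MonoidalCategory C]

/-- The space of morphisms from `X` to `Y` in the quotient category `C / I`. -/
abbrev QuotHom (I : TensorIdeal k C) (X Y : C) : Type _ := (X ⟶ Y) ⧸ I.hom X Y

/-- The quotient functor `C → C / I` on morphisms. -/
def proj (I : TensorIdeal k C) {X Y : C} : (X ⟶ Y) →ₗ[k] I.QuotHom X Y := (I.hom X Y).mkQ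

end TensorIdeal

/-! ### The diagrams -/

namespace THom

variable {δ : ℂ}

/-- The trivalent vertex `go ⊗ go → go`. -/
def merge : THom δ 2 1 := mk Diag.merge

/-- The crossing. -/
def cross : THom δ 2 2 := mk Diag.cross

/-- The cup `𝟙 → go ⊗ go`. -/
def cup : THom δ 0 2 := mk Diag.cup

/-- The cap `go ⊗ go → 𝟙`. -/
def cap : THom δ 2 0 := mk Diag.cap

/-- The trivalent vertex `go → go ⊗ go`. -/
def split : THom δ 1 2 := mk Diag.split

/-- The trivalent vertex `𝟙 → go ⊗ go ⊗ go`. -/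
def explode : THom δ 0 3 := cup.comp (tensor (id 1) split : THom δ 2 3)

/-- The diagram `I`: the two bottom ends merge into one strand, which splits again. -/
def diagI : THom δ 2 2 := merge.comp split

/-- The diagram `H`: two vertical strands joined by a horizontal one. -/
def diagH : THom δ 2 2 := (tensor (id 1) split : THom δ 2 3).comp (tensor merge (id 1) : THom δ 3 2)

/-- The dotted crossing, that is, two crossing strands joined by an edge: the left strand splits,
its right branch crosses the right strand, which then merges into the left branch. -/
def dotcross : THom δ 2 2 :=
  ((tensor split (id 1) : THom δ 2 3).comp (tensor (id 1) cross : THom δ 3 3)).comp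
    (tensor merge (id 1) : THom δ 3 2)

/-- The pentagon with one leg at each corner, two legs at the bottom and three at the top:
the lower edge (an `H`), then the left and right corners, then the top corner. -/
def pentagon : THom δ 2 3 :=
  (diagH.comp (tensor split split : THom δ 2 4)).comp
    (tensor (tensor (id 1) merge) (id 1) : THom δ 4 3)

/-- Both bottom strands split and the two inner strands merge. -/
def tree₁ : THom δ 2 3 :=
  (tensor split split : THom δ 2 4).comp (tensor (tensor (id 1) merge) (id 1) : THom δ 4 3)

/-- The bottom strands merge, the result splits, and the left branch splits again. -/
def tree₂ : THom δ 2 3 := (merge.comp split).comp (tensor split (id 1) : THom δ 2 3)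

/-- The bottom strands merge, the result splits, and the right branch splits again. -/
def tree₃ : THom δ 2 3 := (merge.comp split).comp (tensor (id 1) split : THom δ 2 3)

/-- `tree₁` with its two bottom ends interchanged. -/
def tree₄ : THom δ 2 3 := cross.comp tree₁

/-- A cap below a trivalent vertex with three upper ends. -/
def arc₁ : THom δ 2 3 := cap.comp explode

/-- A vertical strand on the left, the right strand splits. -/
def arc₂ : THom δ 2 3 := tensor (id 1) split

/-- A vertical strand on the right, the left strand splits. -/
def arc₃ : THom δ 2 3 := tensor split (id 1)

/-- The bottom strands merge and go to the top right, with a cup at the top left. -/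
def arc₄ : THom δ 2 3 := merge.comp (tensor cup (id 1) : THom δ 1 3)

/-- The bottom strands merge and go to the top left, with a cup at the top right. -/
def arc₅ : THom δ 2 3 := merge.comp (tensor (id 1) cup : THom δ 1 3)

/-- The bottom strands merge and go to the top middle, crossing a cup that joins the two outer
top ends. -/
def arc₆ : THom δ 2 3 :=
  (merge.comp (tensor (id 1) cup : THom δ 1 3)).comp (tensor cross (id 1) : THom δ 3 3)

/-- The left strand splits into the two outer top ends, the right strand goes to the top middle. -/
def arc₇ : THom δ 2 3 :=
  (tensor split (id 1) : THom δ 2 3).comp (tensor (id 1) cross : THom δ 3 3)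

/-- The right strand splits into the two outer top ends, the left strand goes to the top middle. -/
def arc₈ : THom δ 2 3 :=
  (tensor (id 1) split : THom δ 2 3).comp (tensor cross (id 1) : THom δ 3 3)

/-- The right strand splits into the left and middle top ends, the left strand goes to the top
right. -/
def arc₉ : THom δ 2 3 := cross.comp (tensor split (id 1) : THom δ 2 3)

/-- The left strand splits into the middle and right top ends, the right strand goes to the top
left. -/
def arc₁₀ : THom δ 2 3 := cross.comp (tensor (id 1) split : THom δ 2 3)

end THom

/-!
# The pentagon relation

The idea is to detect morphisms `go^{⊗ 2} → go^{⊗ 3}` modulo the ideal by fusing or capping off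
their upper ends, which leads to the smaller spaces of morphisms `go^{⊗ 2} → go^{⊗ 2}` and
`go^{⊗ 2} → go`.

Write `I` and `H` for the two planar trees with four ends.  The Jacobi relation says that crossing
the upper ends of `H` gives `H - I`; capping this by a vertex shows that a triangle is half a
vertex.  Closing up a linear relation between the identity, the crossing, the cap-cup, `I`, `H` and
the square `H ≫ H` on the right, by a cap or by a vertex, produces a linear system for its
coefficients (`TrivalentCalculus.coeff_square`).  For `δ ≠ -2, 3` it follows that the five diagrams
other than the square are independent, so they form a basis because the dimension is `5`, and that
the square is `5 / (6 (δ + 2))` times the sum of the vertex-free diagrams plus `(I + H) / 6`.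

With triangles and squares evaluated, the images of the ten arcs and of six trees under all fusions
and caps can be expressed in this basis (the lemmas `TrivalentCalculus.sum_forest_*`).  Together
with one further operation, `H ⊗ 1` followed by a fusion, these maps are jointly injective on
combinations of the sixteen diagrams (`TrivalentCalculus.eq_zero_of_killed`).  Hence these are
independent and, the dimension being `16`, a basis.  Fusing two ends of a pentagon creates a
triangle or a square, so its images can be computed as well, and the difference of the two sides of
the pentagon relation is found to be annihilated by all those operations
(`TrivalentCalculus.killed_pentagon_sub`); being a combination of basis elements, it vanishes.

The diagrammatic part takes place in `𝒯_δ` itself, where isotopies follow from the interchange law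
by bending and sliding.  The relations needed on at most three strands are then collected in the
structure `TrivalentCalculus`, and the rest is linear algebra over it.
-/

namespace THom

variable {δ : ℂ}

/-! ### Calculus in the strict monoidal category -/

theorem comp_assoc {m n p q : ℕ} (f : THom δ m n) (g : THom δ n p) (h : THom δ p q) :
    (f.comp g).comp h = f.comp (g.comp h) := by
  induction f using ind; induction g using ind; induction h using ind
  exact sound (.comp_assoc _ _ _)

theorem id_comp {m n : ℕ} (f : THom δ m n) : (id m).comp f = f := by
  induction f using ind
  exact sound (.id_comp _)

theorem comp_id {m n : ℕ} (f : THom δ m n) : f.comp (id n) = f := by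
  induction f using ind
  exact sound (.comp_id _)

theorem tensor_id (m n : ℕ) : tensor (id m : THom δ m m) (id n) = id (m + n) :=
  sound (.tensor_id m n)

theorem tensor_comp {m n p m' n' p' : ℕ} (f : THom δ m n) (g : THom δ n p) (f' : THom δ m' n')
    (g' : THom δ n' p') :
    tensor (f.comp g) (f'.comp g') = (tensor f f').comp (tensor g g') := by
  induction f using ind; induction g using ind; induction f' using ind; induction g' using ind
  exact sound (.interchange _ _ _ _)

theorem smul_comp {m n p : ℕ} (c : ℂ) (f : THom δ m n) (g : THom δ n p) :
    (c • f).comp g = c • f.comp g := by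
  induction f using ind; induction g using ind
  exact sound (.smul_comp _ _ _)

theorem comp_smul {m n p : ℕ} (c : ℂ) (f : THom δ m n) (g : THom δ n p) :
    f.comp (c • g) = c • f.comp g := by
  induction f using ind; induction g using ind
  exact sound (.comp_smul _ _ _)

/-- `f ⊗ 1`. -/
def right {m n : ℕ} (f : THom δ m n) : THom δ (m + 1) (n + 1) := tensor f (id 1)

/-- `1 ⊗ f`. -/
def left {m n : ℕ} (f : THom δ m n) : THom δ (1 + m) (1 + n) := tensor (id 1) f

theorem right_comp {m n p : ℕ} (f : THom δ m n) (g : THom δ n p) :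
    right (f.comp g) = (right f).comp (right g) := by
  unfold right
  rw [← tensor_comp, id_comp]

theorem left_comp {m n p : ℕ} (f : THom δ m n) (g : THom δ n p) :
    left (f.comp g) = (left f).comp (left g) := by
  unfold left
  rw [← tensor_comp, id_comp]

theorem right_smul {m n : ℕ} (c : ℂ) (f : THom δ m n) : right (c • f) = c • right f := by
  induction f using ind
  exact sound (.smul_tensor _ _ _)

theorem left_smul {m n : ℕ} (c : ℂ) (f : THom δ m n) : left (c • f) = c • left f := by
  induction f using ind
  exact sound (.tensor_smul _ _ _)

theorem right_add {m n : ℕ} (f g : THom δ m n) : right (f + g) = right f + right g := by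
  induction f using ind; induction g using ind
  exact sound (.add_tensor _ _ _)

theorem left_add {m n : ℕ} (f g : THom δ m n) : left (f + g) = left f + left g := by
  induction f using ind; induction g using ind
  exact sound (.tensor_add _ _ _)

theorem right_zero (m n : ℕ) : right (0 : THom δ m n) = 0 := by
  rw [← zero_smul ℂ (0 : THom δ m n), right_smul, zero_smul]

theorem left_zero (m n : ℕ) : left (0 : THom δ m n) = 0 := by
  rw [← zero_smul ℂ (0 : THom δ m n), left_smul, zero_smul]

theorem right_id (n : ℕ) : right (id n : THom δ n n) = id (n + 1) := tensor_id n 1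

theorem left_id (n : ℕ) : left (id n : THom δ n n) = id (1 + n) := tensor_id 1 n

theorem tensor_comp_tensor_right {m n m' n' : ℕ} (f : THom δ m n) (g : THom δ m' n') :
    (tensor f (id m')).comp (tensor (id n) g) = tensor f g := by
  rw [← tensor_comp, comp_id, id_comp]

theorem tensor_comp_tensor_left {m n m' n' : ℕ} (f : THom δ m n) (g : THom δ m' n') :
    (tensor (id m) g).comp (tensor f (id n')) = tensor f g := by
  rw [← tensor_comp, comp_id, id_comp]

theorem mk_cast_heq {m n m' n' : ℕ} (hm : m = m') (hn : n = n') (f : Diag m n) :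
    HEq (mk (Diag.cast hm hn f) : THom δ m' n') (mk f : THom δ m n) := by
  subst hm hn
  rfl

/-- Strict associativity of the tensor product; the two sides live in hom-types that agree
definitionally as soon as all the exponents are numerals. -/
theorem tensor_assoc {m n m' n' m'' n'' : ℕ} (f : THom δ m n) (g : THom δ m' n')
    (h : THom δ m'' n'') : HEq (tensor (tensor f g) h) (tensor f (tensor g h)) := by
  induction f using ind; induction g using ind; induction h using ind
  exact (mk_cast_heq _ _ _).symm.trans (heq_of_eq (sound (.tensor_assoc _ _ _)))

theorem tensor_unit {m n : ℕ} (f : THom δ m n) : tensor f (id 0) = f := by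
  induction f using ind
  exact sound (.tensor_unit _)

theorem unit_tensor {m n : ℕ} (f : THom δ m n) : HEq (tensor (id 0) f) f := by
  induction f using ind
  exact (mk_cast_heq _ _ _).symm.trans (heq_of_eq (sound (.unit_tensor _)))

/-! ### Relations between the generators -/

theorem right_left_merge : (right (left merge) : THom δ 4 3) = left (right merge) :=
  eq_of_heq (tensor_assoc _ _ _)

theorem right_left_cup : (right (left cup) : THom δ 2 4) = left (right cup) :=
  eq_of_heq (tensor_assoc _ _ _)

theorem right_left_split : (right (left split) : THom δ 3 4) = left (right split) :=
  eq_of_heq (tensor_assoc _ _ _)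

/-- `1 ⊗ 1 ⊗ f`. -/
theorem left_left {m n : ℕ} (f : THom δ m n) : HEq (left (left f)) (tensor (id 2) f) := by
  unfold left
  exact (tensor_assoc _ _ _).symm.trans (by rw [tensor_id])

/-- `f ⊗ 1 ⊗ 1`. -/
theorem right_right {m n : ℕ} (f : THom δ m n) : (right (right f)) = (tensor f (id 2)) := by
  unfold right
  refine (eq_of_heq (tensor_assoc f (id 1) (id 1))).trans ?_
  rw [tensor_id]

theorem zigzag_left : (left cup : THom δ 1 3).comp (right cap : THom δ 3 1) = id 1 :=
  sound .zigzag_left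

theorem zigzag_right : (right cup : THom δ 1 3).comp (left cap : THom δ 3 1) = id 1 :=
  sound .zigzag_right

theorem split_def :
    (split : THom δ 1 2) = (right cup : THom δ 1 3).comp (left merge : THom δ 3 2) :=
  rfl

theorem split_eq :
    (split : THom δ 1 2) = (left cup : THom δ 1 3).comp (right merge : THom δ 3 2) :=
  sound .split_eq

theorem cross_cap :
    (right cross : THom δ 3 3).comp (left cap : THom δ 3 1) =
      (left cross : THom δ 3 3).comp (right cap : THom δ 3 1) :=
  sound .cross_cap

theorem cross_cross : (cross : THom δ 2 2).comp cross = id 2 := sound .cross_cross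

theorem cross_merge :
    (left cross : THom δ 3 3).comp
        ((right cross : THom δ 3 3).comp (left merge : THom δ 3 2)) =
      (right merge : THom δ 3 2).comp cross :=
  sound .cross_merge

theorem split_cross :
    (left split : THom δ 2 3).comp
        ((right cross : THom δ 3 3).comp (left cross : THom δ 3 3)) =
      cross.comp (right split : THom δ 2 3) :=
  sound .split_cross

theorem cap_symm : (cross : THom δ 2 2).comp cap = cap := sound .cap_symm

theorem merge_skew : (cross : THom δ 2 2).comp merge = -merge := sound .merge_skew

theorem bigon : (split : THom δ 1 2).comp merge = id 1 := sound .bigon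

theorem circle : (cup : THom δ 0 2).comp cap = δ • id 0 := sound .circle

/-! ### Isotopies of planar diagrams -/

/-- Two morphisms on disjoint strands can be slid past each other. -/
theorem slide {m n p q : ℕ} (f : THom δ m n) (g : THom δ p q) :
    (tensor (id m) g).comp (tensor f (id q)) = (tensor f (id p)).comp (tensor (id n) g) := by
  rw [tensor_comp_tensor_left, tensor_comp_tensor_right]

theorem slide_merge_cap :
    (left (left merge) : THom δ 4 3).comp (right cap : THom δ 3 1) =
      (right (right cap) : THom δ 4 2).comp merge := by
  have h := slide (cap : THom δ 2 0) merge
  rwa [eq_of_heq (unit_tensor merge), ← eq_of_heq (left_left merge), ← right_right cap] at h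

theorem slide_cap_merge :
    (right (right merge) : THom δ 4 3).comp (left cap : THom δ 3 1) =
      (left (left cap) : THom δ 4 2).comp merge := by
  have h := slide (merge : THom δ 2 1) cap
  rw [tensor_unit, ← right_right, ← eq_of_heq (left_left cap)] at h
  exact h.symm

theorem slide_merge_merge :
    (left (left merge) : THom δ 4 3).comp (right merge : THom δ 3 2) =
      (right (right merge) : THom δ 4 3).comp (left merge : THom δ 3 2) := by
  have h := slide (merge : THom δ 2 1) merge
  rwa [← right_right, ← eq_of_heq (left_left merge)] at h

theorem slide_cap_cap :
    (left (left cap) : THom δ 4 2).comp cap = (right (right cap) : THom δ 4 2).comp cap := by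
  have h := slide (cap : THom δ 2 0) cap
  rwa [eq_of_heq (unit_tensor cap), tensor_unit, ← right_right,
    ← eq_of_heq (left_left cap)] at h

theorem slide_cross_cap :
    (left (left cross) : THom δ 4 4).comp (right (right cap) : THom δ 4 2) =
      (right (right cap) : THom δ 4 2).comp cross := by
  have h := slide (cap : THom δ 2 0) cross
  rwa [eq_of_heq (unit_tensor cross), ← eq_of_heq (left_left cross), ← right_right cap] at h

theorem slide_cup_cross :
    (left (left cup) : THom δ 2 4).comp (right (right cross) : THom δ 4 4) =
      (cross : THom δ 2 2).comp (left (left cup) : THom δ 2 4) := by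
  have h := slide (cross : THom δ 2 2) cup
  rwa [tensor_unit, ← eq_of_heq (left_left cup), ← right_right cross] at h

theorem slide_split_split :
    (left split : THom δ 2 3).comp (right (right split) : THom δ 3 4) = tensor split split := by
  rw [right_right]
  exact tensor_comp_tensor_left _ _

theorem slide_split_split' :
    (right split : THom δ 2 3).comp (left (left split) : THom δ 3 4) = tensor split split := by
  rw [eq_of_heq (left_left split)]
  exact tensor_comp_tensor_right _ _

theorem slide_cup_split :
    (left cup : THom δ 1 3).comp (right (right split) : THom δ 3 4) =
      (split : THom δ 1 2).comp (left (left cup) : THom δ 2 4) := by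
  have h := slide (split : THom δ 1 2) cup
  rwa [tensor_unit, ← eq_of_heq (left_left cup), ← right_right split] at h

theorem slide_split_merge :
    (left (left split) : THom δ 3 4).comp (right (right merge) : THom δ 4 3) =
      (right merge : THom δ 3 2).comp (left split : THom δ 2 3) := by
  have h := slide (merge : THom δ 2 1) split
  rwa [← eq_of_heq (left_left split), ← right_right merge] at h

theorem right_zigzag_left :
    (right (left cup) : THom δ 2 4).comp (right (right cap) : THom δ 4 2) = id 2 := by
  have h := congrArg right (zigzag_left (δ := δ))
  rwa [right_comp, right_id] at h

theorem right_zigzag_right :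
    (right (right cup) : THom δ 2 4).comp (right (left cap) : THom δ 4 2) = id 2 := by
  have h := congrArg right (zigzag_right (δ := δ))
  rwa [right_comp, right_id] at h

theorem left_zigzag_left :
    (left (left cup) : THom δ 2 4).comp (left (right cap) : THom δ 4 2) = id 2 := by
  have h := congrArg left (zigzag_left (δ := δ))
  rwa [left_comp, left_id] at h

theorem left_zigzag_right :
    (left (right cup) : THom δ 2 4).comp (left (left cap) : THom δ 4 2) = id 2 := by
  have h := congrArg left (zigzag_right (δ := δ))
  rwa [left_comp, left_id] at h

/-- `merge` is `split` with its left upper leg bent down. -/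
theorem left_split_cap :
    (left split : THom δ 2 3).comp (right cap : THom δ 3 1) = merge := by
  have h : (left split : THom δ 2 3) =
      (left (right cup) : THom δ 2 4).comp (left (left merge) : THom δ 4 3) :=
    left_comp (right cup : THom δ 1 3) (left merge : THom δ 3 2)
  rw [h, comp_assoc, slide_merge_cap, ← comp_assoc, ← right_left_cup, right_zigzag_left, id_comp]

/-- `merge` is `split` with its right upper leg bent down. -/
theorem right_split_cap :
    (right split : THom δ 2 3).comp (left cap : THom δ 3 1) = merge := by
  have h : (right split : THom δ 2 3) =
      (right (left cup) : THom δ 2 4).comp (right (right merge) : THom δ 4 3) := by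
    rw [split_eq]
    exact right_comp (left cup : THom δ 1 3) (right merge : THom δ 3 2)
  rw [h, comp_assoc, slide_cap_merge, ← comp_assoc, right_left_cup, left_zigzag_right, id_comp]

theorem diagH_def :
    (diagH : THom δ 2 2) = (left split : THom δ 2 3).comp (right merge : THom δ 3 2) := rfl

/-- The two ways of drawing the horizontal edge of `H` agree: each is the cup between the strands
followed by a merge on either side. -/
theorem diagH_eq :
    (diagH : THom δ 2 2) = (right split : THom δ 2 3).comp (left merge : THom δ 3 2) := by
  have h : (left split : THom δ 2 3) =
      (left (right cup) : THom δ 2 4).comp (left (left merge) : THom δ 4 3) :=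
    left_comp (right cup : THom δ 1 3) (left merge : THom δ 3 2)
  have h' : (right split : THom δ 2 3) =
      (right (left cup) : THom δ 2 4).comp (right (right merge) : THom δ 4 3) := by
    rw [split_eq]
    exact right_comp (left cup : THom δ 1 3) (right merge : THom δ 3 2)
  rw [diagH_def, h, h', comp_assoc, comp_assoc, slide_merge_merge, right_left_cup]

/-- The form `cap` is invariant under the product. -/
theorem right_merge_cap :
    (right merge : THom δ 3 2).comp cap = (left merge : THom δ 3 2).comp cap := by
  have h : (right merge : THom δ 3 2) =
      (right (left split) : THom δ 3 4).comp (right (right cap) : THom δ 4 2) := by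
    rw [← left_split_cap]
    exact right_comp (left split : THom δ 2 3) (right cap : THom δ 3 1)
  have h' : (left merge : THom δ 3 2) =
      (left (right split) : THom δ 3 4).comp (left (left cap) : THom δ 4 2) := by
    rw [← right_split_cap]
    exact left_comp (right split : THom δ 2 3) (left cap : THom δ 3 1)
  rw [h, h', comp_assoc, comp_assoc, slide_cap_cap, right_left_split]

theorem right_left_cap : (right (left cap) : THom δ 4 2) = left (right cap) :=
  eq_of_heq (tensor_assoc _ _ _)

/-- A morphism `go → go ⊗ go ⊗ go` is determined by bending its left upper leg down. -/
theorem ext_bend_13 {f g : THom δ 1 3}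
    (h : (left f : THom δ 2 4).comp (right (right cap) : THom δ 4 2) =
      (left g : THom δ 2 4).comp (right (right cap) : THom δ 4 2)) : f = g := by
  suffices H : ∀ f : THom δ 1 3, f = (right cup : THom δ 1 3).comp
      (left ((left f : THom δ 2 4).comp (right (right cap) : THom δ 4 2)) : THom δ 3 3) by
    rw [H f, H g, h]
  intro f
  have h₁ : (right cup : THom δ 1 3).comp (left (left f) : THom δ 3 5) =
      f.comp (right (right (right cup)) : THom δ 3 5) := by
    have h := slide (cup : THom δ 0 2) f
    rw [eq_of_heq (unit_tensor f), ← eq_of_heq (left_left f)] at h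
    refine h.symm.trans ?_
    rw [right_right]
    unfold right
    rw [← tensor_id 1 2]
    exact congrArg f.comp (eq_of_heq (tensor_assoc cup (id 1) (id 2))).symm
  have h₂ : (left (right (right cap)) : THom δ 5 3) = right (right (left cap)) := by
    rw [right_left_cap]
    exact (eq_of_heq (tensor_assoc (id 1) (right cap : THom δ 3 1) (id 1))).symm
  have h₃ : (right (right (right cup)) : THom δ 3 5).comp (right (right (left cap)) : THom δ 5 3) =
      id 3 := by
    have h := congrArg right (right_zigzag_right (δ := δ))
    rwa [right_comp, right_id] at h
  rw [show (left ((left f : THom δ 2 4).comp (right (right cap) : THom δ 4 2)) : THom δ 3 3) =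
    (left (left f) : THom δ 3 5).comp (left (right (right cap)) : THom δ 5 3) from left_comp _ _,
    ← comp_assoc, h₁, h₂, comp_assoc, h₃, comp_id]

/-- A morphism `𝟙 → go ⊗ go` is determined by bending its left leg down. -/
theorem ext_bend_02 {f g : THom δ 0 2}
    (h : (left f : THom δ 1 3).comp (right cap : THom δ 3 1) =
      (left g : THom δ 1 3).comp (right cap : THom δ 3 1)) : f = g := by
  suffices H : ∀ f : THom δ 0 2, f = (cup : THom δ 0 2).comp
      (left ((left f : THom δ 1 3).comp (right cap : THom δ 3 1)) : THom δ 2 2) by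
    rw [H f, H g, h]
  intro f
  have h₁ : (cup : THom δ 0 2).comp (left (left f) : THom δ 2 4) =
      f.comp (right (right cup) : THom δ 2 4) := by
    have h := slide (cup : THom δ 0 2) f
    rw [eq_of_heq (unit_tensor f), ← eq_of_heq (left_left f), tensor_unit, ← right_right] at h
    exact h.symm
  rw [show (left ((left f : THom δ 1 3).comp (right cap : THom δ 3 1)) : THom δ 2 2) =
    (left (left f) : THom δ 2 4).comp (left (right cap) : THom δ 4 2) from left_comp _ _,
    ← comp_assoc, h₁, comp_assoc, ← right_left_cap, right_zigzag_right, comp_id]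

theorem left_cross_left_cross :
    (left cross : THom δ 3 3).comp (left cross : THom δ 3 3) = id 3 := by
  have h := congrArg left (cross_cross (δ := δ))
  rwa [left_comp, left_id] at h

/-! ### Crossings, cups and vertices -/

/-- A strand can be pulled across a cup: the dual of `cross_cap`, obtained from it by bending. -/
theorem cross_cup :
    (left cup : THom δ 1 3).comp (right cross : THom δ 3 3) =
      (right cup : THom δ 1 3).comp (left cross : THom δ 3 3) := by
  -- The crossings move one at a time around the bend, where they cancel.
  have key : (left cup : THom δ 1 3).comp
      ((right cross : THom δ 3 3).comp (left cross : THom δ 3 3)) = (right cup : THom δ 1 3) := by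
    apply ext_bend_13
    have e₁ : (left ((left cup : THom δ 1 3).comp
        ((right cross : THom δ 3 3).comp (left cross : THom δ 3 3))) : THom δ 2 4) =
        (left (left cup) : THom δ 2 4).comp ((left (right cross) : THom δ 4 4).comp
          (left (left cross) : THom δ 4 4)) := by
      rw [← show (left ((right cross : THom δ 3 3).comp (left cross : THom δ 3 3)) : THom δ 4 4) =
        (left (right cross) : THom δ 4 4).comp (left (left cross) : THom δ 4 4) from left_comp _ _]
      exact left_comp _ _
    have e₂ : (left (right cross) : THom δ 4 4).comp (right (right cap) : THom δ 4 2) =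
        (right (right cross) : THom δ 4 4).comp (left (right cap) : THom δ 4 2) := by
      have e : (right (left cross) : THom δ 4 4) = left (right cross) :=
        eq_of_heq (tensor_assoc _ _ _)
      have h := congrArg right (cross_cap (δ := δ))
      rw [right_comp, right_comp] at h
      rw [← e, ← right_left_cap]
      exact h.symm
    rw [e₁, comp_assoc, comp_assoc, slide_cross_cap, ← comp_assoc (left (right cross) : THom δ 4 4),
      e₂, comp_assoc, ← comp_assoc, slide_cup_cross, comp_assoc,
      ← comp_assoc _ (left (right cap) : THom δ 4 2), left_zigzag_left, id_comp, cross_cross,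
      ← right_left_cup, right_zigzag_left]
  rw [← key, comp_assoc, comp_assoc, left_cross_left_cross, comp_id]

theorem neg_comp {m n p : ℕ} (f : THom δ m n) (g : THom δ n p) : (-f).comp g = -f.comp g :=
  smul_comp (-1) f g

theorem comp_neg {m n p : ℕ} (f : THom δ m n) (g : THom δ n p) : f.comp (-g) = -f.comp g :=
  comp_smul (-1) f g

theorem right_neg {m n : ℕ} (f : THom δ m n) : right (-f) = -right f := right_smul (-1) f

theorem left_neg {m n : ℕ} (f : THom δ m n) : left (-f) = -left f := left_smul (-1) f

theorem eq_zero_of_eq_neg {m n : ℕ} {f : THom δ m n} (h : f = -f) : f = 0 := by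
  have h' : (2 : ℂ) • f = 0 := by
    rw [two_smul]
    nth_rewrite 1 [h]
    exact neg_add_cancel f
  exact (smul_eq_zero.1 h').resolve_left two_ne_zero

theorem left_cross_cap : (left cross : THom δ 3 3).comp (left cap : THom δ 3 1) = left cap := by
  have h := congrArg left (cap_symm (δ := δ))
  rwa [left_comp] at h

theorem left_cross_merge :
    (left cross : THom δ 3 3).comp (left merge : THom δ 3 2) = -left merge := by
  have h := congrArg left (merge_skew (δ := δ))
  rwa [left_comp, left_neg] at h

theorem cup_symm : (cup : THom δ 0 2).comp cross = cup := by
  apply ext_bend_02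
  rw [show (left ((cup : THom δ 0 2).comp cross) : THom δ 1 3) =
    (left cup : THom δ 1 3).comp (left cross : THom δ 3 3) from left_comp _ _, comp_assoc,
    ← cross_cap, ← comp_assoc, cross_cup, comp_assoc, left_cross_cap, zigzag_left, zigzag_right]

theorem left_cup_cross : (left cup : THom δ 1 3).comp (left cross : THom δ 3 3) = left cup := by
  have h := congrArg left (cup_symm (δ := δ))
  rwa [left_comp] at h

theorem split_skew : (split : THom δ 1 2).comp cross = -split := by
  rw [split_eq, comp_assoc, ← cross_merge, ← comp_assoc, left_cup_cross, ← comp_assoc, cross_cup,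
    comp_assoc, left_cross_merge, comp_neg, ← split_def, split_eq]

theorem cup_merge : (cup : THom δ 0 2).comp merge = 0 := by
  apply eq_zero_of_eq_neg
  rw [← comp_neg, ← merge_skew, ← comp_assoc, cup_symm]

theorem split_cap : (split : THom δ 1 2).comp cap = 0 := by
  apply eq_zero_of_eq_neg
  rw [← neg_comp, ← split_skew, comp_assoc, cap_symm]

/-! ### The diagrams `H`, `D` and `tree₁` -/

theorem diagH_cap : (diagH : THom δ 2 2).comp cap = cap := by
  have h := congrArg left (bigon (δ := δ))
  rw [left_comp, left_id] at h
  rw [diagH_def, comp_assoc, right_merge_cap, ← comp_assoc]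
  exact (congrArg (fun f : THom δ 2 2 => f.comp cap) h).trans (id_comp _)

theorem diagH_comp_cross : (diagH : THom δ 2 2).comp cross = cross.comp diagH := by
  have h := congrArg left (split_skew (δ := δ))
  rw [left_comp, left_neg] at h
  have h₁ : (diagH : THom δ 2 2).comp cross = -(left split : THom δ 2 3).comp
      ((right cross : THom δ 3 3).comp (left merge : THom δ 3 2)) := by
    rw [diagH_def, comp_assoc, ← cross_merge, ← comp_assoc (left split),
      show (left split : THom δ 2 3).comp (left cross : THom δ 3 3) = -left split from h, neg_comp]
  have h₂ : (cross : THom δ 2 2).comp diagH = -(left split : THom δ 2 3).comp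
      ((right cross : THom δ 3 3).comp (left merge : THom δ 3 2)) := by
    rw [diagH_eq, ← comp_assoc, ← split_cross, comp_assoc, comp_assoc, left_cross_merge, comp_neg,
      comp_neg]
  rw [h₁, h₂]

/-- The dotted crossing is `diagH` with its lower ends interchanged, up to sign. -/
theorem dotcross_eq : (dotcross : THom δ 2 2) = -cross.comp diagH := by
  have h : (right split : THom δ 2 3).comp (left cross : THom δ 3 3) =
      cross.comp ((left split : THom δ 2 3).comp (right cross : THom δ 3 3)) := by
    have h := congrArg (fun f => (cross.comp f).comp (left cross : THom δ 3 3))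
      (split_cross (δ := δ))
    simp only [comp_assoc] at h
    rw [left_cross_left_cross, comp_id, ← comp_assoc cross cross, cross_cross, id_comp] at h
    exact h.symm
  have h' := congrArg right (merge_skew (δ := δ))
  rw [right_comp, right_neg] at h'
  rw [show (dotcross : THom δ 2 2) = ((right split : THom δ 2 3).comp
    (left cross : THom δ 3 3)).comp (right merge : THom δ 3 2) from rfl, h, comp_assoc, comp_assoc,
    show (right cross : THom δ 3 3).comp (right merge : THom δ 3 2) = -right merge from h',
    comp_neg, comp_neg, diagH_def]

theorem tree₁_eq_right :
    (tree₁ : THom δ 2 3) = (left split : THom δ 2 3).comp (right diagH : THom δ 3 3) := by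
  have h := congrArg right (diagH_eq (δ := δ))
  rw [right_comp] at h
  rw [h, ← comp_assoc]
  exact (congrArg (fun f : THom δ 2 4 => f.comp (right (left merge) : THom δ 4 3))
    slide_split_split).symm

theorem tree₁_eq_left :
    (tree₁ : THom δ 2 3) = (right split : THom δ 2 3).comp (left diagH : THom δ 3 3) := by
  have h := congrArg left (diagH_def (δ := δ))
  rw [left_comp] at h
  rw [h, ← comp_assoc]
  exact (congrArg₂ (fun (f : THom δ 2 4) (g : THom δ 4 3) => f.comp g)
    slide_split_split' right_left_merge.symm).symm

theorem left_cup_comp_right_diagH :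
    (left cup : THom δ 1 3).comp (right diagH : THom δ 3 3) =
      (split : THom δ 1 2).comp (left split : THom δ 2 3) := by
  have h := congrArg right (diagH_eq (δ := δ))
  rw [right_comp] at h
  have h' := congrArg left (split_eq (δ := δ))
  rw [left_comp] at h'
  rw [h, h', ← comp_assoc, ← comp_assoc]
  exact congrArg₂ (fun (f : THom δ 1 4) (g : THom δ 4 3) => f.comp g)
    slide_cup_split right_left_merge

theorem cup_diagH : (cup : THom δ 0 2).comp diagH = cup := by
  apply ext_bend_02
  have h : (left diagH : THom δ 3 3) = (left (left split) : THom δ 3 4).comp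
      (left (right merge) : THom δ 4 3) := left_comp _ _
  have h' := congrArg right (right_merge_cap (δ := δ))
  rw [right_comp, right_comp] at h'
  rw [show (left ((cup : THom δ 0 2).comp diagH) : THom δ 1 3) =
    (left cup : THom δ 1 3).comp (left diagH : THom δ 3 3) from left_comp _ _, h, comp_assoc,
    comp_assoc, ← right_left_merge,
    show (right (left merge) : THom δ 4 3).comp (right cap : THom δ 3 1) =
      (right (right merge) : THom δ 4 3).comp (right cap : THom δ 3 1) from h'.symm,
    ← comp_assoc (left (left split) : THom δ 3 4), slide_split_merge, comp_assoc, left_split_cap,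
    ← comp_assoc, ← split_eq, bigon, zigzag_left]

end THom

/-! ### The quotient category -/

namespace TensorIdeal

variable {k : Type*} {C : Type*} [Field k] [Category C] [Preadditive C] [Linear k C]
  [MonoidalCategory C]

theorem proj_surjective (I : TensorIdeal k C) {X Y : C} :
    Function.Surjective (I.proj : (X ⟶ Y) →ₗ[k] I.QuotHom X Y) :=
  Submodule.mkQ_surjective _

theorem proj_eq_iff (I : TensorIdeal k C) {X Y : C} {f g : X ⟶ Y} :
    I.proj f = I.proj g ↔ f - g ∈ I.hom X Y :=
  Submodule.Quotient.eq _

/-- Composition of morphisms modulo a tensor ideal. -/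
def quotComp (I : TensorIdeal k C) {X Y Z : C} (f : I.QuotHom X Y) (g : I.QuotHom Y Z) :
    I.QuotHom X Z :=
  Quotient.map₂ (fun (f : X ⟶ Y) (g : Y ⟶ Z) => f ≫ g) (fun f f' hf g g' hg => by
    have hf' : f - f' ∈ I.hom X Y := (Submodule.quotientRel_def _).1 hf
    have hg' : g - g' ∈ I.hom Y Z := (Submodule.quotientRel_def _).1 hg
    refine (Submodule.quotientRel_def _).2 ?_
    have h : f ≫ g - f' ≫ g' = (f - f') ≫ g + f' ≫ (g - g') := by
      rw [Preadditive.sub_comp, Preadditive.comp_sub, sub_add_sub_cancel]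
    rw [h]
    exact add_mem (I.mem_comp _ hf' g) (I.comp_mem f' _ hg')) f g

/-- The category `C / I`; its morphisms are the spaces `I.QuotHom X Y`. -/
structure QuotCat (I : TensorIdeal k C) where
  /-- The underlying object of `C`. -/
  obj : C

instance (I : TensorIdeal k C) : Category I.QuotCat where
  Hom X Y := I.QuotHom X.obj Y.obj
  id X := I.proj (𝟙 X.obj)
  comp f g := I.quotComp f g
  id_comp f := by
    obtain ⟨f, rfl⟩ := I.proj_surjective f
    exact congrArg I.proj (Category.id_comp f)
  comp_id f := by
    obtain ⟨f, rfl⟩ := I.proj_surjective f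
    exact congrArg I.proj (Category.comp_id f)
  assoc f g h := by
    obtain ⟨f, rfl⟩ := I.proj_surjective f
    obtain ⟨g, rfl⟩ := I.proj_surjective g
    obtain ⟨h, rfl⟩ := I.proj_surjective h
    exact congrArg I.proj (Category.assoc f g h)

instance (I : TensorIdeal k C) : Preadditive I.QuotCat where
  homGroup X Y := inferInstanceAs (AddCommGroup (I.QuotHom X.obj Y.obj))
  add_comp _ _ _ f f' g := by
    obtain ⟨f, rfl⟩ := I.proj_surjective f
    obtain ⟨f', rfl⟩ := I.proj_surjective f'
    obtain ⟨g, rfl⟩ := I.proj_surjective g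
    exact congrArg I.proj (Preadditive.add_comp _ _ _ f f' g)
  comp_add _ _ _ f g g' := by
    obtain ⟨f, rfl⟩ := I.proj_surjective f
    obtain ⟨g, rfl⟩ := I.proj_surjective g
    obtain ⟨g', rfl⟩ := I.proj_surjective g'
    exact congrArg I.proj (Preadditive.comp_add _ _ _ f g g')

instance (I : TensorIdeal k C) : Linear k I.QuotCat where
  homModule X Y := inferInstanceAs (Module k (I.QuotHom X.obj Y.obj))
  smul_comp _ _ _ c f g := by
    obtain ⟨f, rfl⟩ := I.proj_surjective f
    obtain ⟨g, rfl⟩ := I.proj_surjective g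
    exact congrArg I.proj (Linear.smul_comp _ _ _ c f g)
  comp_smul _ _ _ f c g := by
    obtain ⟨f, rfl⟩ := I.proj_surjective f
    obtain ⟨g, rfl⟩ := I.proj_surjective g
    exact congrArg I.proj (Linear.comp_smul _ _ _ f c g)

end TensorIdeal

namespace THom

variable {δ : ℂ} (I : TensorIdeal ℂ (Tcat δ))

/-- The object `go^{⊗ n}` of `𝒯_δ / I`. -/
abbrev goQ (n : ℕ) : I.QuotCat := ⟨Tcat.goPow δ n⟩

/-- The class of a morphism in `𝒯_δ / I`. -/
noncomputable def cls {m n : ℕ} (f : THom δ m n) : goQ I m ⟶ goQ I n :=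
  I.proj (X := Tcat.goPow δ m) (Y := Tcat.goPow δ n) f

theorem cls_comp {m n p : ℕ} (f : THom δ m n) (g : THom δ n p) :
    cls I (f.comp g) = cls I f ≫ cls I g := rfl

theorem cls_id (n : ℕ) : cls I (id n) = 𝟙 (goQ I n) := rfl

theorem cls_add {m n : ℕ} (f g : THom δ m n) : cls I (f + g) = cls I f + cls I g := rfl

theorem cls_smul {m n : ℕ} (c : ℂ) (f : THom δ m n) : cls I (c • f) = c • cls I f := rfl

theorem cls_neg {m n : ℕ} (f : THom δ m n) : cls I (-f) = -cls I f :=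
  (cls_smul I (-1) f).trans (neg_one_smul ℂ _)

theorem cls_right_congr {m n : ℕ} {f g : THom δ m n} (h : cls I f = cls I g) :
    cls I (right f) = cls I (right g) := by
  have h' : f - g ∈ I.hom (Tcat.goPow δ m) (Tcat.goPow δ n) := I.proj_eq_iff.1 h
  refine I.proj_eq_iff.2 ?_
  have e : right f - right g = right (f - g) := by
    rw [sub_eq_add_neg, sub_eq_add_neg, ← right_neg, ← right_add]
  exact e ▸ I.whiskerRight_mem (X := Tcat.goPow δ m) (Y := Tcat.goPow δ n) _ h' (Tcat.goPow δ 1)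

theorem cls_left_congr {m n : ℕ} {f g : THom δ m n} (h : cls I f = cls I g) :
    cls I (left f) = cls I (left g) := by
  have h' : f - g ∈ I.hom (Tcat.goPow δ m) (Tcat.goPow δ n) := I.proj_eq_iff.1 h
  refine I.proj_eq_iff.2 ?_
  have e : left f - left g = left (f - g) := by
    rw [sub_eq_add_neg, sub_eq_add_neg, ← left_neg, ← left_add]
  exact e ▸ I.whiskerLeft_mem (X := Tcat.goPow δ m) (Y := Tcat.goPow δ n) (Tcat.goPow δ 1) _ h'

end THom

/-! ### Trivalent calculus on at most three strands -/

/-- Four objects `X₀, X₁, X₂, X₃` of a `ℂ`-linear category, to be thought of as the powers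
`go^{⊗ n}` for `n ≤ 3`, together with the generating morphisms between them and the relations that
hold in a quotient of `𝒯_δ` satisfying the Jacobi relation.

The letters are `m` for the merge, `y` for the split, `s` for the crossing, `u` and `c` for cup and
cap, and `H` for the diagram `H`.  The index `1` means that an idle strand is added on the right,
the index `2` that it is added on the left; composition is written from bottom to top. -/
structure TrivalentCalculus (δ : ℂ) {𝒞 : Type*} [Category 𝒞] [Preadditive 𝒞] [Linear ℂ 𝒞]
    (X₀ X₁ X₂ X₃ : 𝒞) where
  m : X₂ ⟶ X₁
  y : X₁ ⟶ X₂
  s : X₂ ⟶ X₂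
  u : X₀ ⟶ X₂
  c : X₂ ⟶ X₀
  H : X₂ ⟶ X₂
  m₁ : X₃ ⟶ X₂
  m₂ : X₃ ⟶ X₂
  y₁ : X₂ ⟶ X₃
  y₂ : X₂ ⟶ X₃
  s₁ : X₃ ⟶ X₃
  s₂ : X₃ ⟶ X₃
  u₁ : X₁ ⟶ X₃
  u₂ : X₁ ⟶ X₃
  c₁ : X₃ ⟶ X₁
  c₂ : X₃ ⟶ X₁
  H₁ : X₃ ⟶ X₃
  H₂ : X₃ ⟶ X₃
  s_s : s ≫ s = 𝟙 X₂
  s_m : s ≫ m = -m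
  s_c : s ≫ c = c
  y_m : y ≫ m = 𝟙 X₁
  u_m : u ≫ m = 0
  H_c : H ≫ c = c
  u_H : u ≫ H = u
  H_m : H ≫ m = (1 / 2 : ℂ) • m
  y_H : y ≫ H = (1 / 2 : ℂ) • y
  s_H : s ≫ H = H - m ≫ y
  H_s : H ≫ s = H - m ≫ y
  y₁_m₁ : y₁ ≫ m₁ = 𝟙 X₂
  y₂_m₂ : y₂ ≫ m₂ = 𝟙 X₂
  y₂_m₁ : y₂ ≫ m₁ = H
  y₁_m₂ : y₁ ≫ m₂ = H
  y₁_c₁ : y₁ ≫ c₁ = 0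
  y₂_c₂ : y₂ ≫ c₂ = 0
  y₂_c₁ : y₂ ≫ c₁ = m
  y₁_c₂ : y₁ ≫ c₂ = m
  u₁_m₁ : u₁ ≫ m₁ = 0
  u₂_m₂ : u₂ ≫ m₂ = 0
  u₂_m₁ : u₂ ≫ m₁ = y
  u₁_m₂ : u₁ ≫ m₂ = y
  u₁_c₁ : u₁ ≫ c₁ = δ • 𝟙 X₁
  u₂_c₂ : u₂ ≫ c₂ = δ • 𝟙 X₁
  u₂_c₁ : u₂ ≫ c₁ = 𝟙 X₁
  u₁_c₂ : u₁ ≫ c₂ = 𝟙 X₁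
  y₂_s₂ : y₂ ≫ s₂ = -y₂
  s₁_m₁ : s₁ ≫ m₁ = -m₁
  s₂_m₂ : s₂ ≫ m₂ = -m₂
  s₁_c₁ : s₁ ≫ c₁ = c₁
  s₂_c₂ : s₂ ≫ c₂ = c₂
  u₁_s₁ : u₁ ≫ s₁ = u₁
  u₂_s₂ : u₂ ≫ s₂ = u₂
  s₁_s₁ : s₁ ≫ s₁ = 𝟙 X₃
  s₂_s₂ : s₂ ≫ s₂ = 𝟙 X₃
  y₂_s₁_s₂ : y₂ ≫ s₁ ≫ s₂ = s ≫ y₁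
  s₁_c₂ : s₁ ≫ c₂ = s₂ ≫ c₁
  u₂_s₁ : u₂ ≫ s₁ = u₁ ≫ s₂
  H₁_m₁ : H₁ ≫ m₁ = (1 / 2 : ℂ) • m₁
  H₂_m₂ : H₂ ≫ m₂ = (1 / 2 : ℂ) • m₂
  H₁_c₁ : H₁ ≫ c₁ = c₁
  H₂_c₂ : H₂ ≫ c₂ = c₂
  u₁_H₁ : u₁ ≫ H₁ = u₁
  y₁_H₁ : y₁ ≫ H₁ = (1 / 2 : ℂ) • y₁
  s₁_H₁ : s₁ ≫ H₁ = H₁ - m₁ ≫ y₁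
  H₂_s₂ : H₂ ≫ s₂ = H₂ - m₂ ≫ y₂
  y₁_H₂ : y₁ ≫ H₂ = y₂ ≫ H₁
  u₂_H₁ : u₂ ≫ H₁ = y ≫ y₂

namespace THom

variable {δ : ℂ} (I : TensorIdeal ℂ (Tcat δ))

/-- The Jacobi relation, solved for the crossed `H`. -/
theorem cls_cross_diagH (hJ : cls I dotcross = cls I diagI - cls I diagH) :
    cls I (cross.comp diagH) = cls I (diagH + (-1 : ℂ) • merge.comp split) := by
  have h : cls I dotcross = -cls I (cross.comp diagH) := by
    rw [dotcross_eq, cls_neg]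
  rw [cls_add, cls_smul, neg_one_smul, ← neg_neg (cls I (cross.comp diagH)), ← h, hJ]
  change -(cls I diagI - cls I diagH) = _ + -cls I diagI
  abel

/-- The triangle is half a vertex: capping the Jacobi relation by `merge` turns its left-hand side
into the triangle as well. -/
theorem cls_diagH_merge (hJ : cls I dotcross = cls I diagI - cls I diagH) :
    cls I (diagH.comp merge) = cls I ((1 / 2 : ℂ) • merge) := by
  have h := cls_cross_diagH I hJ
  rw [← diagH_comp_cross] at h
  have h' := congrArg (· ≫ cls I merge) h
  simp only [cls_add, cls_smul, cls_comp, Category.assoc, Preadditive.add_comp,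
    Linear.smul_comp] at h'
  rw [← cls_comp I cross, merge_skew, ← cls_comp I split, bigon, cls_neg, cls_id, Category.comp_id,
    Preadditive.comp_neg] at h'
  rw [cls_smul, cls_comp]
  linear_combination (norm := module) (-1 / 2 : ℂ) • h'

theorem cls_split_diagH (hJ : cls I dotcross = cls I diagI - cls I diagH) :
    cls I (split.comp diagH) = cls I ((1 / 2 : ℂ) • split) := by
  have h' := congrArg (cls I split ≫ ·) (cls_cross_diagH I hJ)
  simp only [cls_add, cls_smul, cls_comp, Preadditive.comp_add, Linear.comp_smul] at h'
  rw [← Category.assoc, ← Category.assoc, ← cls_comp I split cross, ← cls_comp I split merge,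
    split_skew, bigon, cls_neg, cls_id, Category.id_comp, Preadditive.neg_comp] at h'
  rw [cls_smul, cls_comp]
  linear_combination (norm := module) (-1 / 2 : ℂ) • h'

theorem cls_right_comp {m n p : ℕ} {f : THom δ m n} {g : THom δ n p} {h : THom δ m p}
    (e : cls I (f.comp g) = cls I h) : cls I (right f) ≫ cls I (right g) = cls I (right h) := by
  rw [← cls_comp, ← right_comp]
  exact cls_right_congr I e

theorem cls_left_comp {m n p : ℕ} {f : THom δ m n} {g : THom δ n p} {h : THom δ m p}
    (e : cls I (f.comp g) = cls I h) : cls I (left f) ≫ cls I (left g) = cls I (left h) := by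
  rw [← cls_comp, ← left_comp]
  exact cls_left_congr I e

theorem cls_right_neg {m n : ℕ} (f : THom δ m n) : cls I (right (-f)) = -cls I (right f) := by
  rw [right_neg, cls_neg]

theorem cls_left_neg {m n : ℕ} (f : THom δ m n) : cls I (left (-f)) = -cls I (left f) := by
  rw [left_neg, cls_neg]

theorem cls_right_smul {m n : ℕ} (c : ℂ) (f : THom δ m n) :
    cls I (right (c • f)) = c • cls I (right f) := by
  rw [right_smul, cls_smul]

theorem cls_left_smul {m n : ℕ} (c : ℂ) (f : THom δ m n) :
    cls I (left (c • f)) = c • cls I (left f) := by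
  rw [left_smul, cls_smul]

/-- The diagrams on at most three strands in `𝒯_δ / I`, when the Jacobi relation holds there. -/
noncomputable def trivalentCalculus (hJ : cls I dotcross = cls I diagI - cls I diagH) :
    TrivalentCalculus δ (goQ I 0) (goQ I 1) (goQ I 2) (goQ I 3) where
  m := cls I merge
  y := cls I split
  s := cls I cross
  u := cls I cup
  c := cls I cap
  H := cls I diagH
  m₁ := cls I (right merge)
  m₂ := cls I (left merge)
  y₁ := cls I (right split)
  y₂ := cls I (left split)
  s₁ := cls I (right cross)
  s₂ := cls I (left cross)
  u₁ := cls I (right cup)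
  u₂ := cls I (left cup)
  c₁ := cls I (right cap)
  c₂ := cls I (left cap)
  H₁ := cls I (right diagH)
  H₂ := cls I (left diagH)
  s_s := congrArg (cls I) cross_cross
  s_m := (congrArg (cls I) merge_skew).trans (cls_neg I _)
  s_c := congrArg (cls I) cap_symm
  y_m := congrArg (cls I) bigon
  u_m := congrArg (cls I) cup_merge
  H_c := congrArg (cls I) diagH_cap
  u_H := congrArg (cls I) cup_diagH
  H_m := cls_diagH_merge I hJ
  y_H := cls_split_diagH I hJ
  s_H := by
    rw [← cls_comp, cls_cross_diagH I hJ, cls_add, cls_smul, neg_one_smul, sub_eq_add_neg, cls_comp]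
  H_s := by
    rw [← cls_comp, diagH_comp_cross, cls_cross_diagH I hJ, cls_add, cls_smul, neg_one_smul,
      sub_eq_add_neg, cls_comp]
  y₁_m₁ := (cls_right_comp I (congrArg (cls I) bigon)).trans (congrArg (cls I) (right_id 1))
  y₂_m₂ := (cls_left_comp I (congrArg (cls I) bigon)).trans (congrArg (cls I) (left_id 1))
  y₂_m₁ := rfl
  y₁_m₂ := (congrArg (cls I) diagH_eq).symm
  y₁_c₁ := (cls_right_comp I (congrArg (cls I) split_cap)).trans
    (congrArg (cls I) (right_zero 1 0))
  y₂_c₂ := (cls_left_comp I (congrArg (cls I) split_cap)).trans (congrArg (cls I) (left_zero 1 0))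
  y₂_c₁ := congrArg (cls I) left_split_cap
  y₁_c₂ := congrArg (cls I) right_split_cap
  u₁_m₁ := (cls_right_comp I (congrArg (cls I) cup_merge)).trans
    (congrArg (cls I) (right_zero 0 1))
  u₂_m₂ := (cls_left_comp I (congrArg (cls I) cup_merge)).trans (congrArg (cls I) (left_zero 0 1))
  u₂_m₁ := (congrArg (cls I) split_eq).symm
  u₁_m₂ := rfl
  u₁_c₁ := (cls_right_comp I (congrArg (cls I) circle)).trans
    ((cls_right_smul I δ _).trans (congrArg (δ • cls I ·) (right_id 0)))
  u₂_c₂ := (cls_left_comp I (congrArg (cls I) circle)).trans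
    ((cls_left_smul I δ _).trans (congrArg (δ • cls I ·) (left_id 0)))
  u₂_c₁ := congrArg (cls I) zigzag_left
  u₁_c₂ := congrArg (cls I) zigzag_right
  y₂_s₂ := (cls_left_comp I (congrArg (cls I) split_skew)).trans (cls_left_neg I _)
  s₁_m₁ := (cls_right_comp I (congrArg (cls I) merge_skew)).trans (cls_right_neg I _)
  s₂_m₂ := (cls_left_comp I (congrArg (cls I) merge_skew)).trans (cls_left_neg I _)
  s₁_c₁ := cls_right_comp I (congrArg (cls I) cap_symm)
  s₂_c₂ := cls_left_comp I (congrArg (cls I) cap_symm)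
  u₁_s₁ := cls_right_comp I (congrArg (cls I) cup_symm)
  u₂_s₂ := cls_left_comp I (congrArg (cls I) cup_symm)
  s₁_s₁ := (cls_right_comp I (congrArg (cls I) cross_cross)).trans (congrArg (cls I) (right_id 2))
  s₂_s₂ := (cls_left_comp I (congrArg (cls I) cross_cross)).trans (congrArg (cls I) (left_id 2))
  y₂_s₁_s₂ := congrArg (cls I) split_cross
  s₁_c₂ := congrArg (cls I) cross_cap
  u₂_s₁ := congrArg (cls I) cross_cup
  H₁_m₁ := (cls_right_comp I (cls_diagH_merge I hJ)).trans (cls_right_smul I _ _)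
  H₂_m₂ := (cls_left_comp I (cls_diagH_merge I hJ)).trans (cls_left_smul I _ _)
  H₁_c₁ := cls_right_comp I (congrArg (cls I) diagH_cap)
  H₂_c₂ := cls_left_comp I (congrArg (cls I) diagH_cap)
  u₁_H₁ := cls_right_comp I (congrArg (cls I) cup_diagH)
  y₁_H₁ := (cls_right_comp I (cls_split_diagH I hJ)).trans (cls_right_smul I _ _)
  s₁_H₁ := by
    refine (cls_right_comp I (cls_cross_diagH I hJ)).trans ?_
    rw [right_add, cls_add, cls_right_smul, right_comp, neg_one_smul, ← sub_eq_add_neg]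
    rfl
  H₂_s₂ := by
    have h := cls_cross_diagH I hJ
    rw [← diagH_comp_cross] at h
    refine (cls_left_comp I h).trans ?_
    rw [left_add, cls_add, cls_left_smul, left_comp, neg_one_smul, ← sub_eq_add_neg]
    rfl
  y₁_H₂ := congrArg (cls I) (tree₁_eq_left.symm.trans tree₁_eq_right)
  u₂_H₁ := congrArg (cls I) left_cup_comp_right_diagH

end THom

namespace TrivalentCalculus

variable {δ : ℂ} {𝒞 : Type*} [Category 𝒞] [Preadditive 𝒞] [Linear ℂ 𝒞] {X₀ X₁ X₂ X₃ : 𝒞}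
  (T : TrivalentCalculus δ X₀ X₁ X₂ X₃)

/-! ### Evaluation of small diagrams -/

theorem u₂_s₁_c₂ : T.u₂ ≫ T.s₁ ≫ T.c₂ = 𝟙 X₁ := by
  rw [reassoc_of% T.u₂_s₁, T.s₂_c₂, T.u₁_c₂]

theorem u₂_s₁_m₂ : T.u₂ ≫ T.s₁ ≫ T.m₂ = -T.y := by
  rw [reassoc_of% T.u₂_s₁, T.s₂_m₂, Preadditive.comp_neg, T.u₁_m₂]

theorem y₂_H₁_c₂ : T.y₂ ≫ T.H₁ ≫ T.c₂ = T.m := by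
  rw [← reassoc_of% T.y₁_H₂, T.H₂_c₂, T.y₁_c₂]

theorem y₂_H₁_m₂ : T.y₂ ≫ T.H₁ ≫ T.m₂ = (1 / 2 : ℂ) • T.H := by
  rw [← reassoc_of% T.y₁_H₂, T.H₂_m₂, Linear.comp_smul, T.y₁_m₂]

theorem y₂_H₁_c₁ : T.y₂ ≫ T.H₁ ≫ T.c₁ = T.m := by rw [T.H₁_c₁, T.y₂_c₁]

theorem y₂_H₁_m₁ : T.y₂ ≫ T.H₁ ≫ T.m₁ = (1 / 2 : ℂ) • T.H := by
  rw [T.H₁_m₁, Linear.comp_smul, T.y₂_m₁]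

theorem coeff_of_smul_id [Nontrivial (X₁ ⟶ X₁)] {a b : ℂ} (h : a • 𝟙 X₁ = b • 𝟙 X₁) : a = b := by
  have h0 : 𝟙 X₁ ≠ 0 := fun h0 => by
    obtain ⟨f, hf⟩ := exists_ne (0 : X₁ ⟶ X₁)
    exact hf (by rw [← Category.id_comp f, h0, Limits.zero_comp])
  exact smul_left_injective ℂ h0 h

theorem coeff_of_smul_y [Nontrivial (X₁ ⟶ X₁)] {a b : ℂ} (h : a • T.y = b • T.y) : a = b :=
  coeff_of_smul_id (by simpa [T.y_m] using congrArg (· ≫ T.m) h)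

theorem coeff_of_smul_m [Nontrivial (X₁ ⟶ X₁)] {a b : ℂ} (h : a • T.m = b • T.m) : a = b :=
  coeff_of_smul_id (by simpa [T.y_m] using congrArg (T.y ≫ ·) h)

/-- A linear relation between the five basic diagrams and the square `H ≫ H` is determined by the
coefficient of the square.  Five equations for the coefficients come from adding a strand on the
right, placing a cup below and a cap or a vertex above, with or without a crossing first.  Taking
`r = 0` shows that the five diagrams are independent, taking `r = 1` evaluates the square. -/
theorem coeff_square [Nontrivial (X₁ ⟶ X₁)] (hδ₁ : δ ≠ -2) (hδ₃ : δ ≠ 3) {a b c d f r : ℂ}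
    (h : a • 𝟙 X₃ + b • T.s₁ + c • (T.c₁ ≫ T.u₁) + d • (T.m₁ ≫ T.y₁) + f • T.H₁ =
      r • (T.H₁ ≫ T.H₁)) :
    a = r * (5 / (6 * (δ + 2))) ∧ b = r * (5 / (6 * (δ + 2))) ∧ c = r * (5 / (6 * (δ + 2))) ∧
      d = r / 6 ∧ f = r / 6 := by
  have E₁ : a + b + δ * c + f = r := by
    have := congrArg (fun g => T.u₁ ≫ g ≫ T.c₂) h
    simp only [Preadditive.add_comp, Preadditive.comp_add, Linear.smul_comp, Linear.comp_smul,
      Category.assoc, Category.id_comp, T.u₁_c₂, reassoc_of% T.u₁_s₁, reassoc_of% T.u₁_c₁,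
      reassoc_of% T.u₁_m₁, Limits.zero_comp, reassoc_of% T.u₁_H₁, Category.id_comp] at this
    apply coeff_of_smul_id (X₁ := X₁)
    rw [← this]
    module
  have E₂ : δ * a + b + c + d = r := by
    have := congrArg (fun g => T.u₂ ≫ g ≫ T.c₂) h
    simp only [Preadditive.add_comp, Preadditive.comp_add, Linear.smul_comp, Linear.comp_smul,
      Category.assoc, Category.id_comp, T.u₂_c₂, T.u₂_s₁_c₂, reassoc_of% T.u₂_c₁, T.u₁_c₂,
      reassoc_of% T.u₂_m₁, T.y₁_c₂, T.y_m, reassoc_of% T.u₂_H₁, T.y₂_c₂, T.y₂_H₁_c₂,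
      Limits.comp_zero] at this
    apply coeff_of_smul_id (X₁ := X₁)
    rw [← this]
    module
  have E₃ : -b + c + d / 2 + f = r / 4 := by
    have := congrArg (fun g => T.u₂ ≫ g ≫ T.m₂) h
    simp only [Preadditive.add_comp, Preadditive.comp_add, Linear.smul_comp, Linear.comp_smul,
      Category.assoc, Category.id_comp, T.u₂_m₂, T.u₂_s₁_m₂, reassoc_of% T.u₂_c₁, T.u₁_m₂,
      reassoc_of% T.u₂_m₁, T.y₁_m₂, T.y_H, reassoc_of% T.u₂_H₁, T.y₂_m₂, T.y₂_H₁_m₂,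
      Category.comp_id] at this
    apply T.coeff_of_smul_y
    linear_combination (norm := module) this
  have hs := congrArg (T.s₁ ≫ ·) h
  simp only [Preadditive.comp_add, Linear.comp_smul, Category.comp_id, reassoc_of% T.s₁_c₁,
    reassoc_of% T.s₁_m₁, T.s₁_s₁, T.s₁_H₁, reassoc_of% T.s₁_H₁, Preadditive.sub_comp,
    Category.assoc, T.y₁_H₁, Preadditive.neg_comp] at hs
  have E₄ : a + δ * b + c - d - f = r / 2 := by
    have := congrArg (fun g => T.u₂ ≫ g ≫ T.c₂) hs
    simp only [Preadditive.add_comp, Preadditive.comp_add, Preadditive.sub_comp,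
      Preadditive.comp_sub, Preadditive.neg_comp, Preadditive.comp_neg,
      Linear.smul_comp, Linear.comp_smul,
      Category.assoc, Category.id_comp, T.u₂_c₂, T.u₂_s₁_c₂, reassoc_of% T.u₂_c₁, T.u₁_c₂,
      reassoc_of% T.u₂_m₁, T.y₁_c₂, T.y_m, reassoc_of% T.u₂_H₁, T.y₂_c₂, T.y₂_H₁_c₂,
      Limits.comp_zero] at this
    apply coeff_of_smul_id (X₁ := X₁)
    linear_combination (norm := module) this
  have E₅ : -a + c - d / 2 + f / 2 = 0 := by
    have := congrArg (fun g => T.u₂ ≫ g ≫ T.m₂) hs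
    simp only [Preadditive.add_comp, Preadditive.comp_add, Preadditive.sub_comp,
      Preadditive.comp_sub, Preadditive.neg_comp, Preadditive.comp_neg,
      Linear.smul_comp, Linear.comp_smul,
      Category.assoc, Category.id_comp, T.u₂_m₂, T.u₂_s₁_m₂, reassoc_of% T.u₂_c₁, T.u₁_m₂,
      reassoc_of% T.u₂_m₁, T.y₁_m₂, T.y_H, reassoc_of% T.u₂_H₁, T.y₂_m₂, T.y₂_H₁_m₂,
      Category.comp_id] at this
    apply T.coeff_of_smul_y
    linear_combination (norm := module) this
  have h2 : δ + 2 ≠ 0 := fun h => hδ₁ (eq_neg_of_add_eq_zero_left h)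
  have h3 : δ - 3 ≠ 0 := sub_ne_zero.2 hδ₃
  -- The system is singular exactly when `δ = 3` or `δ = -2`.
  have hab : a = b := by
    apply mul_left_cancel₀ h3
    linear_combination E₂ - E₄ - 2 * (E₃ - E₅)
  subst hab
  have hf : f = r / 2 - 2 * d := by linear_combination 2 * (E₃ - E₅)
  subst hf
  have hd : d = r / 6 := by
    apply mul_left_cancel₀ h3
    linear_combination (2 / 3) * (E₁ - E₂ - (δ - 1) * E₅)
  subst hd
  have ha : a = r * (5 / (6 * (δ + 2))) := by
    field_simp
    linear_combination 6 * (E₂ - E₅)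
  have hc : c = a := by linear_combination E₅
  refine ⟨ha, ha, hc.trans ha, rfl, by ring⟩

theorem y₁_s₂ : T.y₁ ≫ T.s₂ = T.s ≫ T.y₂ ≫ T.s₁ := by
  rw [← Category.comp_id (T.y₂ ≫ T.s₁), ← T.s₂_s₂, Category.assoc, reassoc_of% T.y₂_s₁_s₂,
    reassoc_of% T.s_s]

theorem u₁_s₂ : T.u₁ ≫ T.s₂ = T.u₂ ≫ T.s₁ := T.u₂_s₁.symm

theorem y₁_s₂_m₁ : T.y₁ ≫ T.s₂ ≫ T.m₁ = T.m ≫ T.y - T.H := by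
  rw [reassoc_of% T.y₁_s₂, T.s₁_m₁, Preadditive.comp_neg, T.y₂_m₁, Preadditive.comp_neg, T.s_H,
    neg_sub]

theorem y₁_s₂_c₁ : T.y₁ ≫ T.s₂ ≫ T.c₁ = -T.m := by
  rw [reassoc_of% T.y₁_s₂, T.s₁_c₁, T.y₂_c₁, T.s_m]

theorem y₂_s₂_m₁ : T.y₂ ≫ T.s₂ ≫ T.m₁ = -T.H := by
  rw [reassoc_of% T.y₂_s₂, Preadditive.neg_comp, T.y₂_m₁]

theorem y₂_s₂_c₁ : T.y₂ ≫ T.s₂ ≫ T.c₁ = -T.m := by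
  rw [reassoc_of% T.y₂_s₂, Preadditive.neg_comp, T.y₂_c₁]

theorem y₂_s₁_m₁ : T.y₂ ≫ T.s₁ ≫ T.m₁ = -T.H := by
  rw [T.s₁_m₁, Preadditive.comp_neg, T.y₂_m₁]

theorem y₂_s₁_m₂ : T.y₂ ≫ T.s₁ ≫ T.m₂ = T.m ≫ T.y - T.H := by
  have h := congrArg (-T.y₂ ≫ T.s₁ ≫ ·) T.s₂_m₂
  simp only [Preadditive.comp_neg, neg_neg] at h
  rw [← h, reassoc_of% T.y₂_s₁_s₂, T.y₁_m₂, T.s_H, neg_sub]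

theorem y₂_s₁_c₁ : T.y₂ ≫ T.s₁ ≫ T.c₁ = T.m := by rw [T.s₁_c₁, T.y₂_c₁]

theorem y₂_s₁_c₂ : T.y₂ ≫ T.s₁ ≫ T.c₂ = -T.m := by rw [T.s₁_c₂, T.y₂_s₂_c₁]

theorem y₂_s₁_s₂_m₁ : T.y₂ ≫ T.s₁ ≫ T.s₂ ≫ T.m₁ = T.s := by
  rw [reassoc_of% T.y₂_s₁_s₂, T.y₁_m₁, Category.comp_id]

theorem y₂_s₁_s₂_c₁ : T.y₂ ≫ T.s₁ ≫ T.s₂ ≫ T.c₁ = 0 := by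
  rw [reassoc_of% T.y₂_s₁_s₂, T.y₁_c₁, Limits.comp_zero]

theorem y₂_s₁_H₁_m₂ : T.y₂ ≫ T.s₁ ≫ T.H₁ ≫ T.m₂ = (1 / 2 : ℂ) • T.H - T.H ≫ T.H := by
  rw [reassoc_of% T.s₁_H₁, Preadditive.sub_comp, Preadditive.comp_sub, T.y₂_H₁_m₂, Category.assoc,
    T.y₁_m₂, reassoc_of% T.y₂_m₁]

theorem y₂_H₁_s₂ : T.y₂ ≫ T.H₁ ≫ T.s₂ = T.y₂ ≫ T.H₁ - T.H ≫ T.y₂ := by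
  rw [← reassoc_of% T.y₁_H₂, T.H₂_s₂, Preadditive.comp_sub, T.y₁_H₂, reassoc_of% T.y₁_m₂]

theorem y₂_H₁_s₂_m₁ : T.y₂ ≫ T.H₁ ≫ T.s₂ ≫ T.m₁ = (1 / 2 : ℂ) • T.H - T.H ≫ T.H := by
  rw [reassoc_of% T.y₂_H₁_s₂, Preadditive.sub_comp, Category.assoc, Category.assoc, T.y₂_H₁_m₁,
    T.y₂_m₁]

theorem y₂_H₁_s₂_c₁ : T.y₂ ≫ T.H₁ ≫ T.s₂ ≫ T.c₁ = (1 / 2 : ℂ) • T.m := by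
  rw [reassoc_of% T.y₂_H₁_s₂, Preadditive.sub_comp, Category.assoc, Category.assoc, T.y₂_H₁_c₁,
    T.y₂_c₁, T.H_m]
  module

theorem y₁_H₁_m₂ : T.y₁ ≫ T.H₁ ≫ T.m₂ = (1 / 2 : ℂ) • T.H := by
  rw [reassoc_of% T.y₁_H₁, Linear.smul_comp, T.y₁_m₂]

theorem u₁_s₂_m₁ : T.u₁ ≫ T.s₂ ≫ T.m₁ = -T.y := by
  rw [reassoc_of% T.u₁_s₂, T.s₁_m₁, Preadditive.comp_neg, T.u₂_m₁]

theorem u₁_s₂_c₁ : T.u₁ ≫ T.s₂ ≫ T.c₁ = 𝟙 X₁ := by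
  rw [reassoc_of% T.u₁_s₂, T.s₁_c₁, T.u₂_c₁]

theorem u₁_H₁_m₂ : T.u₁ ≫ T.H₁ ≫ T.m₂ = T.y := by rw [reassoc_of% T.u₁_H₁, T.u₁_m₂]

theorem u₂_s₂_m₁ : T.u₂ ≫ T.s₂ ≫ T.m₁ = T.y := by rw [reassoc_of% T.u₂_s₂, T.u₂_m₁]

theorem u₂_s₂_c₁ : T.u₂ ≫ T.s₂ ≫ T.c₁ = 𝟙 X₁ := by rw [reassoc_of% T.u₂_s₂, T.u₂_c₁]

theorem u₂_H₁_m₂ : T.u₂ ≫ T.H₁ ≫ T.m₂ = T.y := by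
  rw [reassoc_of% T.u₂_H₁, T.y₂_m₂, Category.comp_id]

theorem u₂_s₁_m₁ : T.u₂ ≫ T.s₁ ≫ T.m₁ = -T.y := by
  rw [T.s₁_m₁, Preadditive.comp_neg, T.u₂_m₁]

theorem u₂_s₁_c₁ : T.u₂ ≫ T.s₁ ≫ T.c₁ = 𝟙 X₁ := by rw [T.s₁_c₁, T.u₂_c₁]

theorem u₂_s₁_s₂ : T.u₂ ≫ T.s₁ ≫ T.s₂ = T.u₁ := by
  rw [reassoc_of% T.u₂_s₁, T.s₂_s₂, Category.comp_id]

theorem u₂_s₁_s₂_m₁ : T.u₂ ≫ T.s₁ ≫ T.s₂ ≫ T.m₁ = 0 := by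
  rw [reassoc_of% T.u₂_s₁_s₂, T.u₁_m₁]

theorem u₂_s₁_s₂_c₁ : T.u₂ ≫ T.s₁ ≫ T.s₂ ≫ T.c₁ = δ • 𝟙 X₁ := by
  rw [reassoc_of% T.u₂_s₁_s₂, T.u₁_c₁]

theorem u₂_s₁_H₁_m₂ : T.u₂ ≫ T.s₁ ≫ T.H₁ ≫ T.m₂ = (1 / 2 : ℂ) • T.y := by
  rw [reassoc_of% T.s₁_H₁, Preadditive.sub_comp, Preadditive.comp_sub, T.u₂_H₁_m₂, Category.assoc,
    T.y₁_m₂, reassoc_of% T.u₂_m₁, T.y_H]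
  module

theorem H_m_y : T.H ≫ T.m ≫ T.y = (1 / 2 : ℂ) • (T.m ≫ T.y) := by
  rw [reassoc_of% T.H_m, Linear.smul_comp]

/-! ### The sixteen diagrams with two lower and three upper ends -/

/-- The five basic diagrams with two lower and two upper ends are linearly independent. -/
def Independent : Prop :=
  ∀ a b c d f : ℂ, a • 𝟙 X₂ + b • T.s + c • (T.c ≫ T.u) + d • (T.m ≫ T.y) + f • T.H = 0 →
    a = 0 ∧ b = 0 ∧ c = 0 ∧ d = 0 ∧ f = 0

/-- The trees `tree₁, …, tree₄` and the arcs `arc₁, …, arc₁₀`, in this order, followed by two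
further trees; together they turn out to be a basis. -/
def forest (i : Fin 16) : X₂ ⟶ X₃ :=
  ![T.y₂ ≫ T.H₁, T.m ≫ T.y ≫ T.y₁, T.m ≫ T.y ≫ T.y₂, T.s ≫ T.y₂ ≫ T.H₁, T.c ≫ T.u ≫ T.y₂, T.y₂,
    T.y₁, T.m ≫ T.u₁, T.m ≫ T.u₂, T.m ≫ T.u₂ ≫ T.s₁, T.y₁ ≫ T.s₂, T.y₂ ≫ T.s₁, T.s ≫ T.y₁,
    T.s ≫ T.y₂, T.H ≫ T.y₁, T.H ≫ T.y₂] i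

/-- The morphism `w` is annihilated by fusing or capping off any two of its upper ends, and by
fusing the two right upper ends after applying `H ⊗ 1`.  The last condition is needed: the fusions
and caps alone annihilate a nonzero combination of trees and arcs that is antisymmetric in the two
lower ends. -/
structure Killed (w : X₂ ⟶ X₃) : Prop where
  m₁ : w ≫ T.m₁ = 0
  m₂ : w ≫ T.m₂ = 0
  s₂_m₁ : w ≫ T.s₂ ≫ T.m₁ = 0
  c₁ : w ≫ T.c₁ = 0
  c₂ : w ≫ T.c₂ = 0
  s₂_c₁ : w ≫ T.s₂ ≫ T.c₁ = 0
  H₁_m₂ : w ≫ T.H₁ ≫ T.m₂ = 0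

/-- The square is `x` times the sum of the three diagrams without vertices plus a sixth of the sum
of the two trees `I` and `H`; the same with an idle strand on the right. -/
structure SquareRel (x : ℂ) : Prop where
  H_H : T.H ≫ T.H = x • (𝟙 X₂ + T.s + T.c ≫ T.u) +
    (1 / 6 : ℂ) • (T.m ≫ T.y + T.H)
  H₁_H₁ : T.H₁ ≫ T.H₁ = x • (𝟙 X₃ + T.s₁ + T.c₁ ≫ T.u₁) +
    (1 / 6 : ℂ) • (T.m₁ ≫ T.y₁ + T.H₁)

theorem y₂_H₁_H₁_m₂ {x : ℂ} (hsq : T.SquareRel x) : T.y₂ ≫ T.H₁ ≫ T.H₁ ≫ T.m₂ =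
    x • (𝟙 X₂ + (T.m ≫ T.y - T.H) + T.m ≫ T.y) +
      (1 / 6 : ℂ) • (T.H ≫ T.H + (1 / 2 : ℂ) • T.H) := by
  rw [reassoc_of% hsq.H₁_H₁]
  simp only [Preadditive.add_comp, Preadditive.comp_add, Linear.smul_comp, Linear.comp_smul,
    Category.assoc, Category.id_comp, T.y₂_m₂, T.y₂_s₁_m₂, T.u₁_m₂, reassoc_of% T.y₂_c₁, T.y₁_m₂,
    reassoc_of% T.y₂_m₁, T.y₂_H₁_m₂]

theorem sum_forest (z : Fin 16 → ℂ) : ∑ i, z i • T.forest i =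
    z 0 • (T.y₂ ≫ T.H₁) + z 1 • (T.m ≫ T.y ≫ T.y₁) + z 2 • (T.m ≫ T.y ≫ T.y₂) +
      z 3 • (T.s ≫ T.y₂ ≫ T.H₁) + z 4 • (T.c ≫ T.u ≫ T.y₂) + z 5 • T.y₂ + z 6 • T.y₁ +
      z 7 • (T.m ≫ T.u₁) + z 8 • (T.m ≫ T.u₂) + z 9 • (T.m ≫ T.u₂ ≫ T.s₁) +
      z 10 • (T.y₁ ≫ T.s₂) + z 11 • (T.y₂ ≫ T.s₁) + z 12 • (T.s ≫ T.y₁) + z 13 • (T.s ≫ T.y₂) +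
      z 14 • (T.H ≫ T.y₁) + z 15 • (T.H ≫ T.y₂) := by
  simp [Fin.sum_univ_succ, forest]
  abel

/-! ### Images of the sixteen diagrams under fusing and capping -/

theorem sum_forest_m₁ {x : ℂ} (hsq : T.SquareRel x) (z : Fin 16 → ℂ) :
    (∑ i, z i • T.forest i) ≫ T.m₁ =
      (z 6 + x * z 15) • 𝟙 X₂ +
      (z 12 + x * z 15) • T.s +
      (z 4 + x * z 15) • (T.c ≫ T.u) +
      (z 1 + z 2 / 2 - z 3 / 2 + z 8 - z 9 + z 10 - z 13 + z 15 / 6) • (T.m ≫ T.y) +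
      (z 0 / 2 + z 3 / 2 + z 5 - z 10 - z 11 + z 13 + z 14 + z 15 / 6) • T.H := by
  rw [sum_forest]
  simp only [Preadditive.add_comp, Preadditive.comp_neg, Linear.smul_comp, Linear.comp_smul,
    Category.assoc, Category.comp_id, Limits.comp_zero, T.s_H, T.y_H, T.u_H, hsq.H_H, T.y₁_m₁,
    T.y₂_m₁, T.y₂_s₁_m₁, T.y₁_s₂_m₁, T.y₂_H₁_m₁, T.u₁_m₁, T.u₂_m₁, T.u₂_s₁_m₁]
  module

theorem sum_forest_m₂ {x : ℂ} (hsq : T.SquareRel x) (z : Fin 16 → ℂ) :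
    (∑ i, z i • T.forest i) ≫ T.m₂ =
      (z 5 + x * z 14) • 𝟙 X₂ +
      (z 13 + x * z 14) • T.s +
      (z 4 + x * z 14) • (T.c ≫ T.u) +
      (z 1 / 2 + z 2 - z 3 / 2 + z 7 - z 9 + z 11 - z 12 + z 14 / 6) • (T.m ≫ T.y) +
      (z 0 / 2 + z 3 / 2 + z 6 - z 10 - z 11 + z 12 + z 14 / 6 + z 15) • T.H := by
  rw [sum_forest]
  simp only [Preadditive.add_comp, Preadditive.comp_neg, Linear.smul_comp, Linear.comp_smul,
    Category.assoc, Category.comp_id, Limits.comp_zero, T.s_H, T.y_H, hsq.H_H, T.y₁_m₂, T.y₂_m₂,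
    T.y₂_s₁_m₂, T.s₂_m₂, T.y₂_H₁_m₂, T.u₁_m₂, T.u₂_m₂, T.u₂_s₁_m₂]
  module

theorem sum_forest_s₂_m₁ {x : ℂ} (hsq : T.SquareRel x) (z : Fin 16 → ℂ) :
    (∑ i, z i • T.forest i) ≫ T.s₂ ≫ T.m₁ =
      (-x * z 0 - x * z 3 + z 10 - x * z 14 - x * z 15) • 𝟙 X₂ +
      (-x * z 0 - x * z 3 + z 11 - x * z 14 - x * z 15) • T.s +
      (-x * z 0 - x * z 3 - z 4 - x * z 14 - x * z 15) • (T.c ≫ T.u) +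
      (-z 0 / 6 + z 1 / 2 - z 2 / 2 - z 3 / 6 + z 6 - z 7 + z 8 + z 13 + z 14 / 3 - z 15 / 6) •
        (T.m ≫ T.y) +
      (z 0 / 3 + z 3 / 3 - z 5 - z 6 - z 12 - z 13 - z 14 / 6 - z 15 / 6) • T.H := by
  rw [sum_forest]
  simp only [Preadditive.add_comp, Preadditive.comp_add, Preadditive.comp_sub,
    Preadditive.neg_comp, Preadditive.comp_neg, Linear.smul_comp, Linear.comp_smul,
    Category.assoc, Category.comp_id, Limits.comp_zero, T.s_s, reassoc_of% T.s_m, T.s_H,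
    reassoc_of% T.s_c, T.H_m_y, T.y_H, T.u_H, hsq.H_H, reassoc_of% T.y_m, T.y₁_m₁, T.y₁_s₂_m₁,
    T.y₂_s₂_m₁, T.y₂_s₁_s₂_m₁, reassoc_of% T.s₂_s₂, T.y₂_H₁_s₂_m₁, T.u₁_s₂_m₁, T.u₂_s₂_m₁,
    T.u₂_s₁_s₂_m₁]
  module

theorem sum_forest_c₁ (z : Fin 16 → ℂ) :
    (∑ i, z i • T.forest i) ≫ T.c₁ =
      (z 0 + z 2 - z 3 + z 5 + δ * z 7 + z 8 + z 9 - z 10 + z 11 - z 13 + z 15 / 2) • T.m := by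
  rw [sum_forest]
  simp only [Preadditive.add_comp, Linear.smul_comp, Linear.comp_smul, Category.assoc,
    Category.comp_id, Limits.comp_zero, T.s_m, T.H_m, T.y_m, T.u_m, T.y₁_c₁, T.y₂_c₁, T.y₂_s₁_c₁,
    T.y₁_s₂_c₁, T.y₂_H₁_c₁, T.u₁_c₁, T.u₂_c₁, T.u₂_s₁_c₁]
  module

theorem sum_forest_c₂ (z : Fin 16 → ℂ) :
    (∑ i, z i • T.forest i) ≫ T.c₂ =
      (z 0 + z 1 - z 3 + z 6 + z 7 + δ * z 8 + z 9 + z 10 - z 11 - z 12 + z 14 / 2) • T.m := by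
  rw [sum_forest]
  simp only [Preadditive.add_comp, Linear.smul_comp, Linear.comp_smul, Category.assoc,
    Category.comp_id, Limits.comp_zero, T.s_m, T.H_m, T.y_m, T.y₁_c₂, T.y₂_c₂, T.y₂_s₁_c₂,
    T.s₂_c₂, T.y₂_H₁_c₂, T.u₁_c₂, T.u₂_c₂, T.u₂_s₁_c₂]
  module

theorem sum_forest_s₂_c₁ (z : Fin 16 → ℂ) :
    (∑ i, z i • T.forest i) ≫ T.s₂ ≫ T.c₁ =
      (z 0 / 2 - z 1 - z 2 - z 3 / 2 - z 5 - z 6 + z 7 + z 8 + δ * z 9 + z 12 + z 13 - z 14 / 2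
        - z 15 / 2) • T.m := by
  rw [sum_forest]
  simp only [Preadditive.add_comp, Preadditive.comp_neg, Linear.smul_comp, Linear.comp_smul,
    Category.assoc, Category.comp_id, Limits.comp_zero, T.s_m, T.H_m, T.y_m, T.u_m, T.y₁_c₁,
    T.y₁_s₂_c₁, T.y₂_s₂_c₁, T.y₂_s₁_s₂_c₁, reassoc_of% T.s₂_s₂, T.y₂_H₁_s₂_c₁, T.u₁_s₂_c₁,
    T.u₂_s₂_c₁, T.u₂_s₁_s₂_c₁]
  module

theorem sum_forest_H₁_m₂ {x : ℂ} (hsq : T.SquareRel x) (z : Fin 16 → ℂ) :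
    (∑ i, z i • T.forest i) ≫ T.H₁ ≫ T.m₂ =
      (7 * x * z 0 / 6 + x * z 3 / 6 - x * z 10 - x * z 11 + x * z 14 / 2 + x * z 15 / 2) • 𝟙 X₂ +
      (x * z 0 / 6 + 7 * x * z 3 / 6 - x * z 10 - x * z 11 + x * z 14 / 2 + x * z 15 / 2) • T.s +
      (x * z 0 / 6 + x * z 3 / 6 + z 4 / 2 - x * z 10 - x * z 11 + x * z 14 / 2 + x * z 15 / 2)
        • (T.c ≫ T.u) +
      (2 * x * z 0 + z 0 / 36 + z 1 / 4 + z 2 / 4 - x * z 3 - 5 * z 3 / 36 + z 7 + z 8 + z 9 / 2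
        - z 10 / 6 - z 11 / 6 - z 12 / 2 - z 13 / 2 + z 14 / 12 + z 15 / 12) • (T.m ≫ T.y) +
      (-x * z 0 + z 0 / 9 - x * z 3 + z 3 / 9 + z 5 / 2 + z 6 / 2 + z 10 / 3 + z 11 / 3 + z 12 /
        2 + z 13 / 2 + z 14 / 12 + z 15 / 12) • T.H := by
  rw [sum_forest]
  simp only [Preadditive.add_comp, Preadditive.comp_add, Preadditive.comp_sub,
    Preadditive.neg_comp, Linear.smul_comp, Linear.comp_smul, Category.assoc, Category.comp_id,
    T.s_s, reassoc_of% T.s_m, T.s_H, reassoc_of% T.s_c, T.y_H, T.u_H, hsq.H_H,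
    reassoc_of% T.y₁_s₂, T.y₁_H₁_m₂, T.y₂_s₁_H₁_m₂, T.y₂_H₁_m₂, T.y₂_H₁_H₁_m₂ hsq, T.u₁_H₁_m₂,
    T.u₂_H₁_m₂, T.u₂_s₁_H₁_m₂]
  module

/-! ### The pentagon -/

/-- The operations listed in `Killed` are jointly injective on linear combinations of the sixteen
diagrams. -/
theorem eq_zero_of_killed [Nontrivial (X₁ ⟶ X₁)] (hδ₃ : δ ≠ 3) (hA : T.Independent) {x : ℂ}
    (hx : 6 * (δ + 2) * x = 5) (hsq : T.SquareRel x) {z : Fin 16 → ℂ}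
    (hz : T.Killed (∑ i, z i • T.forest i)) : z = 0 := by
  obtain ⟨p₁, p₂, p₃, p₄, p₅⟩ := hA _ _ _ _ _ ((T.sum_forest_m₁ hsq z).symm.trans hz.m₁)
  obtain ⟨q₁, q₂, q₃, q₄, -⟩ := hA _ _ _ _ _ ((T.sum_forest_m₂ hsq z).symm.trans hz.m₂)
  obtain ⟨r₁, r₂, r₃, -, -⟩ := hA _ _ _ _ _ ((T.sum_forest_s₂_m₁ hsq z).symm.trans hz.s₂_m₁)
  obtain ⟨k₁, -, -, k₄, -⟩ := hA _ _ _ _ _ ((T.sum_forest_H₁_m₂ hsq z).symm.trans hz.H₁_m₂)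
  have c₁ := T.coeff_of_smul_m
    ((T.sum_forest_c₁ z).symm.trans (hz.c₁.trans (zero_smul ℂ _).symm))
  have c₂ := T.coeff_of_smul_m
    ((T.sum_forest_c₂ z).symm.trans (hz.c₂.trans (zero_smul ℂ _).symm))
  have c₃ := T.coeff_of_smul_m
    ((T.sum_forest_s₂_c₁ z).symm.trans (hz.s₂_c₁.trans (zero_smul ℂ _).symm))
  have hx0 : x ≠ 0 := by
    rintro rfl
    norm_num at hx
  have h3 : δ - 3 ≠ 0 := sub_ne_zero.2 hδ₃
  -- The equations for the vertex-free diagrams express the coefficients of all arcs other than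
  -- `arc₄`, `arc₅`, `arc₆` through `z 14`, and then `z 14` vanishes.
  have h15 : z 15 = z 14 := by
    apply mul_left_cancel₀ hx0
    linear_combination p₃ - q₃
  have h03 : z 3 = -z 0 - z 14 := by
    apply mul_left_cancel₀ hx0
    linear_combination -r₃ - p₃
  have h14 : z 14 = 0 := by
    apply mul_left_cancel₀ h3
    linear_combination (3 / 2 * (δ + 2)) * (p₅ - q₁ + r₁ + r₂ - q₂) - (3 / 2 * (δ + 2)) *
      ((1 / 2 + 2 * x) * h03 + (1 / 6 + 2 * x) * h15) + z 14 * hx +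
      6 * (δ + 2) * x * (h03 + h15)
  have h15' : z 15 = 0 := h15.trans h14
  have h4 : z 4 = 0 := by linear_combination q₃ - x * h14
  have h5 : z 5 = 0 := by linear_combination q₁ - x * h14
  have h13 : z 13 = 0 := by linear_combination q₂ - x * h14
  have h6 : z 6 = 0 := by linear_combination p₁ - x * h15'
  have h12 : z 12 = 0 := by linear_combination p₂ - x * h15'
  have h10 : z 10 = 0 := by linear_combination r₁ + x * h03 + x * h15'
  have h11 : z 11 = 0 := by linear_combination r₂ + x * h03 + x * h15'
  have h0 : z 0 = 0 := by
    apply mul_left_cancel₀ hx0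
    linear_combination k₁ - x / 6 * h03 + x * h10 + x * h11 - x / 3 * h14 - x / 2 * h15'
  have h3' : z 3 = 0 := by linear_combination h03 - h0 - h14
  simp only [h0, h3', h5, h6, h10, h11, h12, h13, h14, h15', mul_zero, zero_div, add_zero,
    zero_add, sub_zero] at p₄ q₄ k₄ c₁ c₂ c₃
  -- What remains is a system for `tree₂`, `tree₃`, `arc₄`, `arc₅` and `arc₆`.
  have h12' : z 1 = z 2 := by
    apply mul_left_cancel₀ h3
    linear_combination 2 * (c₁ - c₂) + 2 * (δ - 1) * (p₄ - q₄)
  have h78 : z 7 = z 8 := by linear_combination q₄ - p₄ + h12' / 2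
  have h9 : z 9 = 3 / 2 * z 1 + z 8 := by linear_combination -p₄ - h12' / 2
  have h1 : z 1 = -2 * z 8 := by
    linear_combination (4 / 5) * k₄ - (4 / 5) * h78 - (2 / 5) * h9 + (1 / 5) * h12'
  have h8 : z 8 = 0 := by
    apply mul_left_cancel₀ h3
    linear_combination c₁ - δ * h78 - h9 - 5 / 2 * h1 + h12'
  have h1' : z 1 = 0 := by rw [h1, h8, mul_zero]
  funext i
  fin_cases i
  · exact h0
  · exact h1'
  · exact h12'.symm.trans h1'
  · exact h3'
  · exact h4
  · exact h5
  · exact h6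
  · exact h78.trans h8
  · exact h8
  · exact h9.trans (by rw [h1', h8]; norm_num)
  · exact h10
  · exact h11
  · exact h12
  · exact h13
  · exact h14
  · exact h15'

/-- The coefficients of the pentagon with respect to `forest`, in terms of the coefficient `x` of
the vertex-free diagrams in the square. -/
noncomputable def pentagonCoeff (x : ℂ) : Fin 16 → ℂ :=
  ![1 / 12, 1 / 12, 1 / 12, 1 / 12, x / 2, x / 2, x / 2, x / 2, x / 2, x / 2, x / 2, x / 2, x / 2,
    x / 2, 0, 0]

theorem killed_pentagon_sub {x : ℂ} (hx : 6 * (δ + 2) * x = 5) (hsq : T.SquareRel x) :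
    T.Killed (T.H ≫ T.y₂ ≫ T.H₁ - ∑ i, pentagonCoeff x i • T.forest i) := by
  constructor <;> rw [Preadditive.sub_comp, sub_eq_zero]
  · rw [T.sum_forest_m₁ hsq]
    simp only [Category.assoc, T.y₂_H₁_m₁, Linear.comp_smul, hsq.H_H, pentagonCoeff,
      Matrix.cons_val]
    module
  · rw [T.sum_forest_m₂ hsq]
    simp only [Category.assoc, T.y₂_H₁_m₂, Linear.comp_smul, hsq.H_H, pentagonCoeff,
      Matrix.cons_val]
    module
  · rw [T.sum_forest_s₂_m₁ hsq]
    simp only [Category.assoc, T.y₂_H₁_s₂_m₁, Linear.comp_smul, Preadditive.comp_sub, hsq.H_H,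
      Preadditive.comp_add, T.H_s, reassoc_of% T.H_c, T.H_m_y, Category.comp_id,
      pentagonCoeff, Matrix.cons_val]
    module
  · rw [T.sum_forest_c₁]
    simp only [Category.assoc, T.y₂_H₁_c₁, T.H_m, pentagonCoeff, Matrix.cons_val]
    congr 1
    linear_combination (-1 / 12 : ℂ) * hx
  · rw [T.sum_forest_c₂]
    simp only [Category.assoc, T.y₂_H₁_c₂, T.H_m, pentagonCoeff, Matrix.cons_val]
    congr 1
    linear_combination (-1 / 12 : ℂ) * hx
  · rw [T.sum_forest_s₂_c₁]
    simp only [Category.assoc, T.y₂_H₁_s₂_c₁, T.H_m, Linear.comp_smul, smul_smul, pentagonCoeff,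
      Matrix.cons_val]
    congr 1
    linear_combination (-1 / 12 : ℂ) * hx
  · rw [T.sum_forest_H₁_m₂ hsq]
    simp only [Category.assoc, T.y₂_H₁_H₁_m₂ hsq, Linear.comp_smul, Preadditive.comp_sub, hsq.H_H,
      Preadditive.comp_add, T.H_s, reassoc_of% T.H_c, T.H_m_y, Category.comp_id,
      pentagonCoeff, Matrix.cons_val]
    module

theorem linearIndependent_forest [Nontrivial (X₁ ⟶ X₁)] (hδ₃ : δ ≠ 3) (hA : T.Independent) {x : ℂ}
    (hx : 6 * (δ + 2) * x = 5) (hsq : T.SquareRel x) : LinearIndependent ℂ T.forest := by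
  refine Fintype.linearIndependent_iff.2 fun z hz => congrFun (T.eq_zero_of_killed hδ₃ hA hx hsq ?_)
  rw [hz]
  constructor <;> exact Limits.zero_comp

/-- Since the sixteen diagrams form a basis, the pentagon is a combination of them, and its
coefficients are detected by fusing and capping. -/
theorem pentagon_eq [Nontrivial (X₁ ⟶ X₁)] (hδ₃ : δ ≠ 3) (hA : T.Independent) {x : ℂ}
    (hx : 6 * (δ + 2) * x = 5) (hsq : T.SquareRel x) (hdim : Module.finrank ℂ (X₂ ⟶ X₃) = 16) :
    T.H ≫ T.y₂ ≫ T.H₁ = ∑ i, pentagonCoeff x i • T.forest i := by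
  have hspan := (T.linearIndependent_forest hδ₃ hA hx hsq).span_eq_top_of_card_eq_finrank
    (by rw [hdim, Fintype.card_fin])
  obtain ⟨z, hz⟩ := (Submodule.mem_span_range_iff_exists_fun ℂ).1
    (hspan ▸ Submodule.mem_top (x := T.H ≫ T.y₂ ≫ T.H₁ - ∑ i, pentagonCoeff x i • T.forest i))
  have h0 := T.eq_zero_of_killed hδ₃ hA hx hsq (hz ▸ T.killed_pentagon_sub hx hsq)
  rw [← sub_eq_zero, ← hz, h0]
  simp

end TrivalentCalculus

namespace THom

variable {δ : ℂ} (I : TensorIdeal ℂ (Tcat δ))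

/-! ### Consequences of the dimension hypotheses -/

theorem nontrivial_of_finrank_pos (h : 0 < Module.finrank ℂ (goQ I 2 ⟶ goQ I 2)) :
    Nontrivial (goQ I 1 ⟶ goQ I 1) := by
  by_contra hn
  rw [not_nontrivial_iff_subsingleton] at hn
  have h1 : cls I (id 1) = cls I 0 := hn.elim _ _
  have h2 : 𝟙 (goQ I 2) = 0 := by
    have h := cls_right_congr I h1
    rw [right_id, right_zero] at h
    exact h
  have hs : Subsingleton (goQ I 2 ⟶ goQ I 2) := subsingleton_of_forall_eq 0 fun f => by
    rw [← Category.id_comp f, h2, Limits.zero_comp]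
  exact h.ne' Module.finrank_zero_of_subsingleton

/-- A linear relation between two-strand diagrams, with an idle strand added on the right. -/
theorem whisker_relation {a b c d f r : ℂ}
    (h : a • 𝟙 (goQ I 2) + b • cls I cross + c • (cls I cap ≫ cls I cup) +
      d • (cls I merge ≫ cls I split) + f • cls I diagH = r • (cls I diagH ≫ cls I diagH)) :
    a • 𝟙 (goQ I 3) + b • cls I (right cross) + c • (cls I (right cap) ≫ cls I (right cup)) +
      d • (cls I (right merge) ≫ cls I (right split)) + f • cls I (right diagH) =
        r • (cls I (right diagH) ≫ cls I (right diagH)) := by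
  have h' : cls I (a • id 2 + b • cross + c • cap.comp cup + d • merge.comp split + f • diagH) =
      cls I (r • diagH.comp diagH) := h
  have h₁ := cls_right_congr I h'
  simp only [right_add, right_smul, right_comp, right_id] at h₁
  exact h₁

theorem independent (hδ₁ : δ ≠ -2) (hδ₃ : δ ≠ 3) [Nontrivial (goQ I 1 ⟶ goQ I 1)]
    (hJ : cls I dotcross = cls I diagI - cls I diagH) : (trivalentCalculus I hJ).Independent := by
  intro a b c d f h
  have := (trivalentCalculus I hJ).coeff_square (r := 0) hδ₁ hδ₃
    (whisker_relation I (h.trans (zero_smul ℂ _).symm))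
  simpa using this

theorem squareRel (hδ₁ : δ ≠ -2) (hδ₃ : δ ≠ 3) [Nontrivial (goQ I 1 ⟶ goQ I 1)]
    (hJ : cls I dotcross = cls I diagI - cls I diagH)
    (hdim : Module.finrank ℂ (goQ I 2 ⟶ goQ I 2) = 5) :
    (trivalentCalculus I hJ).SquareRel (5 / (6 * (δ + 2))) := by
  have hsum : ∀ z : Fin 5 → ℂ, ∑ i, z i • (![𝟙 (goQ I 2), cls I cross, cls I cap ≫ cls I cup,
      cls I merge ≫ cls I split, cls I diagH] : Fin 5 → (goQ I 2 ⟶ goQ I 2)) i =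
      z 0 • 𝟙 (goQ I 2) + z 1 • cls I cross + z 2 • (cls I cap ≫ cls I cup) +
        z 3 • (cls I merge ≫ cls I split) + z 4 • cls I diagH := fun z => by
    rw [Fin.sum_univ_five]
    rfl
  have hli : LinearIndependent ℂ (![𝟙 (goQ I 2), cls I cross, cls I cap ≫ cls I cup,
      cls I merge ≫ cls I split, cls I diagH] : Fin 5 → (goQ I 2 ⟶ goQ I 2)) := by
    refine Fintype.linearIndependent_iff.2 fun z hz i => ?_
    obtain ⟨h0, h1, h2, h3, h4⟩ := independent I hδ₁ hδ₃ hJ _ _ _ _ _ ((hsum z).symm.trans hz)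
    fin_cases i
    exacts [h0, h1, h2, h3, h4]
  have hspan := hli.span_eq_top_of_card_eq_finrank (by rw [hdim, Fintype.card_fin])
  obtain ⟨z, hz⟩ := (Submodule.mem_span_range_iff_exists_fun ℂ).1
    (hspan ▸ Submodule.mem_top (x := cls I diagH ≫ cls I diagH))
  rw [hsum] at hz
  have hz₁ := whisker_relation I (r := 1) (hz.trans (one_smul ℂ _).symm)
  obtain ⟨h0, h1, h2, h3, h4⟩ := (trivalentCalculus I hJ).coeff_square hδ₁ hδ₃ hz₁
  rw [one_smul] at hz₁
  rw [h0, h1, h2, h3, h4] at hz hz₁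
  constructor
  · refine hz.symm.trans ?_
    simp only [one_mul, smul_add, add_assoc]
    rfl
  · refine hz₁.symm.trans ?_
    simp only [one_mul, smul_add, add_assoc]
    rfl

/-- The pentagon relation, with the diagrams read in the quotient category. -/
theorem cls_pentagon (hδ₁ : δ ≠ -2) (hδ₃ : δ ≠ 3)
    (hJ : cls I dotcross = cls I diagI - cls I diagH)
    (hd₂ : Module.finrank ℂ (goQ I 2 ⟶ goQ I 2) = 5)
    (hd₃ : Module.finrank ℂ (goQ I 2 ⟶ goQ I 3) = 16) :
    cls I pentagon = (1 / 12 : ℂ) • (cls I tree₁ + cls I tree₂ + cls I tree₃ + cls I tree₄) +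
      (5 / (12 * (δ + 2))) • (cls I arc₁ + cls I arc₂ + cls I arc₃ + cls I arc₄ + cls I arc₅ +
        cls I arc₆ + cls I arc₇ + cls I arc₈ + cls I arc₉ + cls I arc₁₀) := by
  have h2 : δ + 2 ≠ 0 := fun h => hδ₁ (eq_neg_of_add_eq_zero_left h)
  have : Nontrivial (goQ I 1 ⟶ goQ I 1) := nontrivial_of_finrank_pos I (by rw [hd₂]; norm_num)
  have key := (trivalentCalculus I hJ).pentagon_eq hδ₃ (independent I hδ₁ hδ₃ hJ)
    (by field_simp) (squareRel I hδ₁ hδ₃ hJ hd₂) hd₃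
  rw [TrivalentCalculus.sum_forest] at key
  have ht : cls I tree₁ = cls I (left split) ≫ cls I (right diagH) :=
    congrArg (cls I) tree₁_eq_right
  have hP : cls I pentagon = cls I diagH ≫ cls I tree₁ :=
    congrArg (cls I) (comp_assoc diagH _ _)
  have e₂ : cls I tree₂ = cls I merge ≫ cls I split ≫ cls I (right split) :=
    congrArg (cls I) (comp_assoc merge split _)
  have e₃ : cls I tree₃ = cls I merge ≫ cls I split ≫ cls I (left split) :=
    congrArg (cls I) (comp_assoc merge split _)
  have e₄ : cls I tree₄ = cls I cross ≫ cls I tree₁ := rfl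
  have f₁ : cls I arc₁ = cls I cap ≫ cls I cup ≫ cls I (left split) := rfl
  have f₆ : cls I arc₆ = cls I merge ≫ cls I (left cup) ≫ cls I (right cross) :=
    congrArg (cls I) (comp_assoc merge _ _)
  rw [hP, e₂, e₃, e₄, ht, f₁, f₆]
  refine key.trans ?_
  have hhalf : 5 / (6 * (δ + 2)) / 2 = 5 / (12 * (δ + 2)) := by rw [div_div]; ring_nf
  simp only [TrivalentCalculus.pentagonCoeff, Matrix.cons_val, hhalf, zero_smul, add_zero, smul_add,
    ← add_assoc]
  rfl

end THom

theorem mainTheorem8 (δ : ℂ) (hδ₁ : δ ≠ -2) (hδ₂ : δ ≠ 0) (hδ₃ : δ ≠ 3)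
    (hδ₄ : δ ≠ (15 + 3 * (Real.sqrt 5 : ℂ)) / 4) (hδ₅ : δ ≠ (15 - 3 * (Real.sqrt 5 : ℂ)) / 4)
    (I : TensorIdeal ℂ (Tcat δ))
    (hdim₂ : Module.finrank ℂ (I.QuotHom (Tcat.goPow δ 2) (Tcat.goPow δ 2)) = 5)
    (hdim₃ : Module.finrank ℂ (I.QuotHom (Tcat.goPow δ 2) (Tcat.goPow δ 3)) = 16)
    (hJacobi : (I.proj THom.dotcross : I.QuotHom (Tcat.goPow δ 2) (Tcat.goPow δ 2)) =
      I.proj THom.diagI - I.proj THom.diagH) :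
    (I.proj THom.pentagon : I.QuotHom (Tcat.goPow δ 2) (Tcat.goPow δ 3)) =
      (1 / 12 : ℂ) •
        (I.proj THom.tree₁ + I.proj THom.tree₂ + I.proj THom.tree₃ + I.proj THom.tree₄) +
      (5 / (12 * (δ + 2))) •
        (I.proj THom.arc₁ + I.proj THom.arc₂ + I.proj THom.arc₃ + I.proj THom.arc₄ +
          I.proj THom.arc₅ + I.proj THom.arc₆ + I.proj THom.arc₇ + I.proj THom.arc₈ +
          I.proj THom.arc₉ + I.proj THom.arc₁₀) :=
  THom.cls_pentagon I hδ₁ hδ₃ hJacobi hdim₂ hdim₃
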